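/- **Proposition.** Let $R$ be a commutative unital ring, $V$ a set, $F(V)$ the free loop on $V$, and $R[[V']]$ the algebra of formal power series over $R$ in the non-associative variables $x'$, $x\in V$; the power series with constant term $1$ form a loop under multiplication. The Magnus expansion $\mathcal M$ is the homomorphism from $F(V)$ to this loop with $\mathcal M(x)=1+x'$ for $x\in V$. In a loop (with left division $\backslash$) put $(a,b,c)=(a(bc))\backslash((ab)c)$, and for indices $1\le\alpha_k\le k+2$ $(k=1,\dots,l)$ define inductively the associator deviation of level $l$ by $$(a_1,\dots,a_{l+3})_{\alpha_1,\dots,\alpha_l}=\bigl(A(a_{\alpha_l})A(a_{\alpha_l+1})\bigr)\backslash A(a_{\alpha_l}a_{\alpha_l+1}),$$ where $A(t)=(a_1,\dots,a_{\alpha_l-1},t,a_{\alpha_l+2},\dots,a_{l+3})_{\alpha_1,\dots,\alpha_{l-1}}$. For $m,n\ge1$ let $$P_{m,n}(x_1,\dots,x_m,y_1,\dots,y_n,z)=(x_1,\dots,x_m,y_1,\dots,y_n,z)_{1,\dots,1,m+1,\dots,m+1},$$ with $m-1$ indices equal to $1$ followed by $n-1$ indices equal to $m+1$. In a unital non-associative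 algebra define the Shestakov–Umirbaev primitive operations $p_{r,s}(x_1,\dots,x_r;y_1,\dots,y_s;z)$, $r,s\ge1$, recursively by $$(uv)z-u(vz)=\sum u_{(1)}v_{(1)}\cdot p(u_{(2)};v_{(2)};z),\qquad u=(\cdots(x_1x_2)\cdots)x_r,\quad v=(\cdots(y_1y_2)\cdots)y_s,$$ where the sum is over all decompositions of the sequences $x_1,\dots,x_r$ and $y_1,\dots,y_s$ into complementary subsequences; $u_{(1)}$, $v_{(1)}$ are the left-normed products of the first subsequences (an empty product is $1$), $p(u_{(2)};v_{(2)};z)$ is the primitive operation applied to the second subsequences and to $z$, and it is $0$ if one of the second subsequences is empty. Then for all $m,n\ge 1$ and all (not necessarily distinct) generators $x_1,\dots,x_m,y_1,\dots,y_n,z\in V$, $$\mathcal M\bigl(P_{m,n}(x_1,\dots,x_m,y_1,\dots,y_n,z)\bigr)=1+p_{m,n}(x'_1,\dots,x'_m;y'_1,\dots,y'_n;z')+O(m+n+2),$$ where $O(m+n+2)$ is a power series without terms of degree less than $m+n+2$. Moreover, $p_{m,n}(x'_1,\dots,x'_m;y'_1,\dots,y'_n;z')$ is homogeneous of degree $m+n+1$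 and, if $R\neq0$, it is non-zero; so it is the leading term of the Magnus expansion of the deviation. -/

import Mathlib

namespace MagnusLoop

universe u v

/-! ### Loops -/

/-- A loop: a (non-associative) multiplication with a two-sided unit, in which left and right
multiplications are bijective; `ldiv a b` is `a \ b` and `rdiv b a` is `b / a`. -/
class Loop (L : Type u) extends MulOneClass L where
  /-- left division `a \ b` -/
  ldiv : L → L → L
  /-- right division `b / a` -/
  rdiv : L → L → L
  mul_ldiv : ∀ a b : L, a * ldiv a b = b
  ldiv_mul : ∀ a b : L, ldiv a (a * b) = b
  rdiv_mul : ∀ b a : L, rdiv b a * a = b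
  mul_rdiv : ∀ b a : L, rdiv (b * a) a = b

/-- The loop associator `(a, b, c) = (a(bc)) \ ((ab)c)`. -/
def loopAssociator {L : Type u} [Loop L] (a b c : L) : L :=
  Loop.ldiv (a * (b * c)) ((a * b) * c)

/-- The associator deviation of level `n`, a function `L ^ (n + 3) → L` indexed by a sequence
`α_1, …, α_n`, where the `k`-th index takes `k + 2` values. All indices start from `0` here:
`α i : Fin (i + 3)` stands for `α_{i+1} - 1`. For `k` the last index, and `A x` the deviation of
level `n` with the remaining indices, taken at the sequence `a` in which the two consecutive
entries at places `k` and `k + 1` are replaced by the single entry `x`, the value is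
`(A (a_k) A (a_{k+1})) \ A (a_k a_{k+1})`. -/
def deviation {L : Type u} [Loop L] :
    (n : ℕ) → (α : (i : Fin n) → Fin ((i : ℕ) + 3)) → (a : Fin (n + 3) → L) → L
  | 0, _, a => loopAssociator (a 0) (a 1) (a 2)
  | n + 1, α, a =>
      let k : Fin (n + 3) := α (Fin.last n)
      let A : L → L := fun x =>
        deviation n (fun i => α i.castSucc) (k.castSucc.contractNth (fun _ _ => x) a)
      Loop.ldiv (A (a k.castSucc) * A (a k.succ)) (A (a k.castSucc * a k.succ))

/-- `P_{m,n}(x_1, …, x_m, y_1, …, y_n, z)` for `m, n ≥ 1`: the deviation of level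
`(m - 1) + (n - 1)` of the sequence `x_1, …, x_m, y_1, …, y_n, z` with indices
`1, …, 1` (`m - 1` times) followed by `m + 1, …, m + 1` (`n - 1` times). -/
def deviationP {L : Type u} [Loop L] (m n : ℕ) (x : Fin m → L) (y : Fin n → L) (z : L) : L :=
  deviation ((m - 1) + (n - 1))
    (fun i => if h : (i : ℕ) < m - 1 then ⟨0, by omega⟩ else ⟨m, by omega⟩)
    (fun j => if h : (j : ℕ) < m then x ⟨j, h⟩
      else if h' : (j : ℕ) - m < n then y ⟨j - m, h'⟩ else z)

/-! ### The free loop -/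

/-- Words in the loop operations on the letters `V`. -/
inductive LoopWord (V : Type u) : Type u
  | of : V → LoopWord V
  | one : LoopWord V
  | mul : LoopWord V → LoopWord V → LoopWord V
  | ldiv : LoopWord V → LoopWord V → LoopWord V
  | rdiv : LoopWord V → LoopWord V → LoopWord V

/-- The congruence on words generated by the loop identities. -/
inductive LoopWord.Rel {V : Type u} : LoopWord V → LoopWord V → Prop
  | refl (a) : Rel a a
  | symm {a b} : Rel a b → Rel b a
  | trans {a b c} : Rel a b → Rel b c → Rel a c
  | mul {a b c d} : Rel a b → Rel c d → Rel (.mul a c) (.mul b d)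
  | ldiv {a b c d} : Rel a b → Rel c d → Rel (.ldiv a c) (.ldiv b d)
  | rdiv {a b c d} : Rel a b → Rel c d → Rel (.rdiv a c) (.rdiv b d)
  | one_mul (a) : Rel (.mul .one a) a
  | mul_one (a) : Rel (.mul a .one) a
  | mul_ldiv (a b) : Rel (.mul a (.ldiv a b)) b
  | ldiv_mul (a b) : Rel (.ldiv a (.mul a b)) b
  | rdiv_mul (b a) : Rel (.mul (.rdiv b a) a) b
  | mul_rdiv (b a) : Rel (.rdiv (.mul b a) a) b

/-- The congruence as a setoid. -/
def LoopWord.setoid (V : Type u) : Setoid (LoopWord V) :=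
  ⟨LoopWord.Rel, .refl, .symm, .trans⟩

/-- The free loop `F(V)`. -/
def FreeLoop (V : Type u) : Type u := Quotient (LoopWord.setoid V)

namespace FreeLoop

variable {V : Type u}

/-- The generators of the free loop. -/
def of (x : V) : FreeLoop V := Quotient.mk (LoopWord.setoid V) (.of x)

instance : One (FreeLoop V) := ⟨Quotient.mk (LoopWord.setoid V) .one⟩

instance : Mul (FreeLoop V) := ⟨Quotient.map₂ .mul fun _ _ h _ _ h' => .mul h h'⟩

instance : Loop (FreeLoop V) where
  ldiv := Quotient.map₂ .ldiv fun _ _ h _ _ h' => .ldiv h h'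
  rdiv := Quotient.map₂ .rdiv fun _ _ h _ _ h' => .rdiv h h'
  one_mul := by
    intro a
    obtain ⟨a, rfl⟩ := Quotient.exists_rep a
    exact Quotient.sound (.one_mul a)
  mul_one := by
    intro a
    obtain ⟨a, rfl⟩ := Quotient.exists_rep a
    exact Quotient.sound (.mul_one a)
  mul_ldiv a b := Quotient.inductionOn₂ a b fun a b => Quotient.sound (.mul_ldiv a b)
  ldiv_mul a b := Quotient.inductionOn₂ a b fun a b => Quotient.sound (.ldiv_mul a b)
  rdiv_mul b a := Quotient.inductionOn₂ b a fun b a => Quotient.sound (.rdiv_mul b a)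
  mul_rdiv b a := Quotient.inductionOn₂ b a fun b a => Quotient.sound (.mul_rdiv b a)

/-- Evaluation of words in a loop. -/
def evalWord {L : Type v} [Loop L] (f : V → L) : LoopWord V → L
  | .of x => f x
  | .one => 1
  | .mul a b => evalWord f a * evalWord f b
  | .ldiv a b => Loop.ldiv (evalWord f a) (evalWord f b)
  | .rdiv a b => Loop.rdiv (evalWord f a) (evalWord f b)

theorem evalWord_rel {L : Type v} [Loop L] (f : V → L) {a b : LoopWord V}
    (h : LoopWord.Rel a b) : evalWord f a = evalWord f b := by
  induction h with
  | refl => rfl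
  | symm _ ih => exact ih.symm
  | trans _ _ ih ih' => exact ih.trans ih'
  | mul _ _ ih ih' => simp only [evalWord, ih, ih']
  | ldiv _ _ ih ih' => simp only [evalWord, ih, ih']
  | rdiv _ _ ih ih' => simp only [evalWord, ih, ih']
  | one_mul a => exact one_mul _
  | mul_one a => exact mul_one _
  | mul_ldiv a b => exact Loop.mul_ldiv _ _
  | ldiv_mul a b => exact Loop.ldiv_mul _ _
  | rdiv_mul a b => exact Loop.rdiv_mul _ _
  | mul_rdiv a b => exact Loop.mul_rdiv _ _

/-- The homomorphism from the free loop to a loop `L` that extends a map of the generators. -/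
def lift {L : Type v} [Loop L] (f : V → L) : FreeLoop V →* L where
  toFun := Quotient.lift (evalWord f) fun _ _ h => evalWord_rel f h
  map_one' := rfl
  map_mul' := by rintro ⟨a⟩ ⟨b⟩; rfl

theorem lift_of {L : Type v} [Loop L] (f : V → L) (x : V) : lift f (of x) = f x := rfl

/-- A homomorphism from the free loop is determined by its values on the generators. -/
theorem eq_lift {L : Type v} [Loop L] (f : V → L) (g : FreeLoop V →* L)
    (h : ∀ x, g (of x) = f x) : g = lift f := by
  have hl : ∀ a b, g (Loop.ldiv a b) = Loop.ldiv (g a) (g b) := fun a b => by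
    conv_rhs => rw [← Loop.mul_ldiv a b, map_mul, Loop.ldiv_mul]
  have hr : ∀ a b, g (Loop.rdiv a b) = Loop.rdiv (g a) (g b) := fun a b => by
    conv_rhs => rw [← Loop.rdiv_mul a b, map_mul, Loop.mul_rdiv]
  ext w
  obtain ⟨w, rfl⟩ := Quotient.exists_rep w
  let mk : LoopWord V → FreeLoop V := Quotient.mk (LoopWord.setoid V)
  induction w with
  | of x => exact h x
  | one => exact map_one g
  | mul a b iha ihb =>
    exact (map_mul g (mk a) (mk b)).trans (congrArg₂ (· * ·) iha ihb)
  | ldiv a b iha ihb =>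
    exact (hl (mk a) (mk b)).trans (congrArg₂ Loop.ldiv iha ihb)
  | rdiv a b iha ihb =>
    exact (hr (mk a) (mk b)).trans (congrArg₂ Loop.rdiv iha ihb)

end FreeLoop

/-! ### Non-associative power series -/

/-- Monomials in the non-associative variables `V`: bracketed words, and the empty monomial `1`. -/
abbrev Monomial (V : Type u) : Type u := WithOne (FreeMagma V)

/-- The degree of a monomial. -/
def Monomial.degree {V : Type u} (w : Monomial V) : ℕ := WithOne.recOneCoe 0 FreeMagma.length w

/-- The list of all factorizations of a bracketed word into two monomials. -/
def wordFactorizations {V : Type u} : FreeMagma V → List (Monomial V × Monomial V)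
  | .of v => [(1, (FreeMagma.of v : Monomial V)), ((FreeMagma.of v : Monomial V), 1)]
  | .mul s t => [(1, ((s * t : FreeMagma V) : Monomial V)), (((s * t : FreeMagma V) : Monomial V), 1),
      ((s : Monomial V), (t : Monomial V))]

/-- The list of all pairs of monomials with product `w`. -/
def factorizations {V : Type u} (w : Monomial V) : List (Monomial V × Monomial V) :=
  WithOne.recOneCoe [(1, 1)] wordFactorizations w

theorem mem_factorizations {V : Type u} (w : Monomial V) (p : Monomial V × Monomial V) :
    p ∈ factorizations w ↔ p.1 * p.2 = w := by
  have h1 : ∀ s : FreeMagma V, (s : Monomial V) ≠ 1 := fun s => WithOne.coe_ne_one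
  have h2 : ∀ s : FreeMagma V, (1 : Monomial V) ≠ s := fun s => WithOne.one_ne_coe
  obtain ⟨a, b⟩ := p
  cases w using WithOne.recOneCoe with
  | one =>
    cases a using WithOne.recOneCoe <;> cases b using WithOne.recOneCoe <;>
      simp [factorizations, ← WithOne.coe_mul, h1]
  | coe w =>
    cases w <;> cases a using WithOne.recOneCoe <;> cases b using WithOne.recOneCoe <;>
      simp [factorizations, wordFactorizations, ← WithOne.coe_mul, h1, h2]
    constructor
    · rintro ⟨rfl, rfl⟩
      rfl
    · intro h
      injection h with h h'
      exact ⟨h, h'⟩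

theorem nodup_factorizations {V : Type u} (w : Monomial V) : (factorizations w).Nodup := by
  cases w using WithOne.recOneCoe with
  | one => simp [factorizations]
  | coe w =>
    cases w with
    | of v => simp [factorizations, wordFactorizations]
    | mul s t =>
      have h : ((s * t : FreeMagma V) : Monomial V) ≠ 1 := WithOne.coe_ne_one
      change List.Nodup [(1, ((s * t : FreeMagma V) : Monomial V)),
        (((s * t : FreeMagma V) : Monomial V), 1), _]
      generalize ((s * t : FreeMagma V) : Monomial V) = w at h
      simp [h.symm]

/-- Formal power series over `R` in the non-associative variables `V`: arbitrary families of
coefficients indexed by the monomials. -/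
def NAPowerSeries (V : Type u) (R : Type v) : Type (max u v) := Monomial V → R

namespace NAPowerSeries

variable {V : Type u} {R : Type v}

/-- The coefficient of a monomial. -/
def coeff (w : Monomial V) (f : NAPowerSeries V R) : R := f w

@[ext] theorem ext {f g : NAPowerSeries V R} (h : ∀ w, coeff w f = coeff w g) : f = g := funext h

/-- Two series are equal if they agree at `1`, at the letters and at the products. -/
theorem ext_cases {f g : NAPowerSeries V R} (h1 : coeff 1 f = coeff 1 g)
    (hof : ∀ v : V, coeff (FreeMagma.of v : Monomial V) f = coeff (FreeMagma.of v : Monomial V) g)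
    (hmul : ∀ s t : FreeMagma V, coeff ((s * t : FreeMagma V) : Monomial V) f =
      coeff ((s * t : FreeMagma V) : Monomial V) g) : f = g := by
  ext w
  cases w using WithOne.recOneCoe with
  | one => exact h1
  | coe w =>
    exact FreeMagma.casesOn (motive := fun w : FreeMagma V => coeff (w : Monomial V) f = coeff (w : Monomial V) g)
      w hof hmul

variable [CommRing R]

instance : AddCommGroup (NAPowerSeries V R) := inferInstanceAs (AddCommGroup (Monomial V → R))

/-- The product of power series: `(f g)_w = ∑ f_a g_b` over the factorizations `w = a b`. -/
instance : Mul (NAPowerSeries V R) :=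
  ⟨fun f g w => ((factorizations w).map fun p => coeff p.1 f * coeff p.2 g).sum⟩

open Classical in
/-- The power series with a single term, a monomial with coefficient `1`. -/
noncomputable def ofMonomial (R : Type v) [CommRing R] (w : Monomial V) : NAPowerSeries V R :=
  fun w' => if w' = w then 1 else 0

noncomputable instance : One (NAPowerSeries V R) := ⟨ofMonomial R 1⟩

/-- The variable `x'` that corresponds to the letter `x`. -/
noncomputable def X (R : Type v) [CommRing R] (x : V) : NAPowerSeries V R :=
  ofMonomial R (FreeMagma.of x : Monomial V)

theorem coeff_mul (w : Monomial V) (f g : NAPowerSeries V R) :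
    coeff w (f * g) = ((factorizations w).map fun p => coeff p.1 f * coeff p.2 g).sum := rfl

theorem coeff_one_mul (f g : NAPowerSeries V R) :
    coeff 1 (f * g) = coeff 1 f * coeff 1 g := by
  simp [coeff_mul, factorizations]

theorem coeff_of_mul (v : V) (f g : NAPowerSeries V R) :
    coeff (FreeMagma.of v : Monomial V) (f * g) =
      coeff 1 f * coeff (FreeMagma.of v : Monomial V) g +
        coeff (FreeMagma.of v : Monomial V) f * coeff 1 g := by
  simp [coeff_mul, factorizations, wordFactorizations]

theorem coeff_mul_mul (s t : FreeMagma V) (f g : NAPowerSeries V R) :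
    coeff ((s * t : FreeMagma V) : Monomial V) (f * g) =
      coeff 1 f * coeff ((s * t : FreeMagma V) : Monomial V) g +
        (coeff ((s * t : FreeMagma V) : Monomial V) f * coeff 1 g +
          coeff (s : Monomial V) f * coeff (t : Monomial V) g) := by
  rw [coeff_mul]
  change List.sum [_, _, _] = _
  simp only [List.sum_cons, List.sum_nil, add_zero]

@[simp] theorem coeff_zero (w : Monomial V) : coeff w (0 : NAPowerSeries V R) = 0 := rfl

@[simp] theorem coeff_add (w : Monomial V) (f g : NAPowerSeries V R) :
    coeff w (f + g) = coeff w f + coeff w g := rfl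

@[simp] theorem coeff_one_one : coeff 1 (1 : NAPowerSeries V R) = 1 := if_pos rfl

@[simp] theorem coeff_coe_one (s : FreeMagma V) :
    coeff (s : Monomial V) (1 : NAPowerSeries V R) = 0 := if_neg WithOne.coe_ne_one

noncomputable instance : NonAssocRing (NAPowerSeries V R) where
  left_distrib f g h := by
    apply ext_cases <;> intros <;>
      simp only [coeff_add, coeff_one_mul, coeff_of_mul, coeff_mul_mul] <;> ring
  right_distrib f g h := by
    apply ext_cases <;> intros <;>
      simp only [coeff_add, coeff_one_mul, coeff_of_mul, coeff_mul_mul] <;> ring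
  zero_mul f := by
    apply ext_cases <;> intros <;>
      simp only [coeff_one_mul, coeff_of_mul, coeff_mul_mul, coeff_zero] <;> ring
  mul_zero f := by
    apply ext_cases <;> intros <;>
      simp only [coeff_one_mul, coeff_of_mul, coeff_mul_mul, coeff_zero] <;> ring
  one_mul f := by
    apply ext_cases <;> intros <;>
      simp only [coeff_one_mul, coeff_of_mul, coeff_mul_mul, coeff_one_one, coeff_coe_one] <;> ring
  mul_one f := by
    apply ext_cases <;> intros <;>
      simp only [coeff_one_mul, coeff_of_mul, coeff_mul_mul, coeff_one_one, coeff_coe_one] <;> ring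

/-- Coefficients, in positive degree, of the solution `c` of `a c = b` with constant term `1`,
for `a` and `b` with constant term `1`. -/
def ldivCoeff (a b : NAPowerSeries V R) : FreeMagma V → R
  | .of v => coeff (FreeMagma.of v : Monomial V) b - coeff (FreeMagma.of v : Monomial V) a
  | .mul s t => coeff ((s * t : FreeMagma V) : Monomial V) b -
      coeff ((s * t : FreeMagma V) : Monomial V) a - coeff (s : Monomial V) a * ldivCoeff a b t

/-- Coefficients, in positive degree, of the solution `c` of `c a = b` with constant term `1`,
for `a` and `b` with constant term `1`. -/
def rdivCoeff (b a : NAPowerSeries V R) : FreeMagma V → R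
  | .of v => coeff (FreeMagma.of v : Monomial V) b - coeff (FreeMagma.of v : Monomial V) a
  | .mul s t => coeff ((s * t : FreeMagma V) : Monomial V) b -
      coeff ((s * t : FreeMagma V) : Monomial V) a - rdivCoeff b a s * coeff (t : Monomial V) a

/-- The power series with constant term `1` and given coefficients in positive degree. -/
def ofCoeff (c : FreeMagma V → R) : NAPowerSeries V R := fun w => WithOne.recOneCoe 1 c w

@[simp] theorem coeff_one_ofCoeff (c : FreeMagma V → R) : coeff 1 (ofCoeff c) = 1 := rfl

@[simp] theorem coeff_coe_ofCoeff (c : FreeMagma V → R) (s : FreeMagma V) :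
    coeff (s : Monomial V) (ofCoeff c) = c s := rfl

end NAPowerSeries

/-- `R_0[[V]]`: the power series with constant term `1`. -/
def UnitSeries (V : Type u) (R : Type v) [CommRing R] : Type (max u v) :=
  {f : NAPowerSeries V R // NAPowerSeries.coeff 1 f = 1}

namespace UnitSeries

open NAPowerSeries

variable {V : Type u} {R : Type v} [CommRing R]

noncomputable instance : One (UnitSeries V R) := ⟨⟨1, coeff_one_one⟩⟩

instance : Mul (UnitSeries V R) :=
  ⟨fun f g => ⟨f.1 * g.1, by rw [coeff_one_mul, f.2, g.2, one_mul]⟩⟩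

theorem val_mul (f g : UnitSeries V R) : (f * g).1 = f.1 * g.1 := rfl

theorem val_one : (1 : UnitSeries V R).1 = 1 := rfl

/-- `R_0[[V]]` is a loop under multiplication of power series. -/
noncomputable instance : Loop (UnitSeries V R) where
  one_mul f := Subtype.ext (one_mul f.1)
  mul_one f := Subtype.ext (mul_one f.1)
  ldiv a b := ⟨ofCoeff (ldivCoeff a.1 b.1), rfl⟩
  rdiv b a := ⟨ofCoeff (rdivCoeff b.1 a.1), rfl⟩
  mul_ldiv a b := by
    refine Subtype.ext (show a.1 * ofCoeff (ldivCoeff a.1 b.1) = b.1 from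
      ext_cases ?_ (fun v => ?_) (fun s t => ?_)) <;>
      simp only [coeff_one_mul, coeff_of_mul, coeff_mul_mul, a.2, b.2, coeff_one_ofCoeff,
        coeff_coe_ofCoeff, ldivCoeff] <;> ring
  ldiv_mul a b := by
    refine Subtype.ext (ext fun w => ?_)
    cases w using WithOne.recOneCoe with
    | one => exact b.2.symm
    | coe w =>
      rw [coeff_coe_ofCoeff]
      induction w using FreeMagma.rec with
      | of v => simp only [ldivCoeff, val_mul, coeff_of_mul, a.2, b.2]; ring
      | mul s t _ ih =>
        rw [ldivCoeff, ih]
        simp only [val_mul, coeff_mul_mul, a.2, b.2]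
        change _ = coeff ((s * t : FreeMagma V) : Monomial V) b.1
        ring
  rdiv_mul b a := by
    refine Subtype.ext (show ofCoeff (rdivCoeff b.1 a.1) * a.1 = b.1 from
      ext_cases ?_ (fun v => ?_) (fun s t => ?_)) <;>
      simp only [coeff_one_mul, coeff_of_mul, coeff_mul_mul, a.2, b.2, coeff_one_ofCoeff,
        coeff_coe_ofCoeff, rdivCoeff] <;> ring
  mul_rdiv b a := by
    refine Subtype.ext (ext fun w => ?_)
    cases w using WithOne.recOneCoe with
    | one => exact b.2.symm
    | coe w =>
      rw [coeff_coe_ofCoeff]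
      induction w using FreeMagma.rec with
      | of v => simp only [rdivCoeff, val_mul, coeff_of_mul, a.2, b.2]; ring
      | mul s t ih _ =>
        rw [rdivCoeff, ih]
        simp only [val_mul, coeff_mul_mul, a.2, b.2]
        change _ = coeff ((s * t : FreeMagma V) : Monomial V) b.1
        ring

end UnitSeries

/-- The Magnus expansion as a homomorphism of loops `F(V) → R_0[[V']]` with `x ↦ 1 + x'`. -/
noncomputable def magnusHom (V : Type u) (R : Type v) [CommRing R] :
    FreeLoop V →* UnitSeries V R :=
  FreeLoop.lift fun x => ⟨1 + NAPowerSeries.X R x, by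
    rw [NAPowerSeries.coeff_add, NAPowerSeries.coeff_one_one]
    exact add_eq_left.mpr (if_neg WithOne.one_ne_coe)⟩

/-- The Magnus expansion of an element of the free loop, as a power series. -/
noncomputable def magnus {V : Type u} (R : Type v) [CommRing R] (w : FreeLoop V) :
    NAPowerSeries V R :=
  (magnusHom V R w).1

/-! ### The primitive operations of Shestakov and Umirbaev -/

section PrimitiveOperations

variable {A : Type u} [NonAssocRing A]

/-- The left-normed product `(…(x_1 x_2)…) x_r`, equal to `1` for the empty sequence. -/
def leftProd {r : ℕ} (x : Fin r → A) : A := (List.ofFn x).foldl (· * ·) 1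

/-- The subsequence of `x` with places in `I`. -/
def subseq {r : ℕ} (x : Fin r → A) (I : Finset (Fin r)) : Fin I.card → A :=
  fun i => x (I.orderEmbOfFin rfl i)

/-- The primitive operations `p_{r,s}(x_1, …, x_r; y_1, …, y_s; z)`, defined recursively by
`(uv)z - u(vz) = ∑ u₁v₁ · p(u₂; v₂; z)` with `u = (…(x_1 x_2)…) x_r`, `v = (…(y_1 y_2)…) y_s`, where
the sum is over all decompositions of the two sequences into complementary subsequences; the
places of `u₂` and `v₂` are `I` and `J` here. The term with `u₂ = u`, `v₂ = v` is
`p_{r,s}(x; y; z)` itself, the other ones involve fewer arguments. Terms with `u₂` or `v₂`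
empty vanish. -/
def primOp (r s : ℕ) (x : Fin r → A) (y : Fin s → A) (z : A) : A :=
  (leftProd x * leftProd y) * z - leftProd x * (leftProd y * z) -
    ∑ I : Finset (Fin r), ∑ J : Finset (Fin s),
      if _h : I.card + J.card < r + s then
        (leftProd (subseq x Iᶜ) * leftProd (subseq y Jᶜ)) *
          primOp I.card J.card (subseq x I) (subseq y J) z
      else 0
termination_by r + s

theorem primOp_eq_zero (r s : ℕ) (x : Fin r → A) (y : Fin s → A) (z : A) (h : r = 0 ∨ s = 0) :
    primOp r s x y z = 0 := by
  induction hn : r + s using Nat.strong_induction_on generalizing r s with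
  | _ n ih =>
    rw [primOp, Finset.sum_eq_zero, sub_zero]
    · rcases h with rfl | rfl <;> simp [leftProd]
    · intro I _
      refine Finset.sum_eq_zero fun J _ => ?_
      split_ifs with hlt
      · rw [ih (I.card + J.card) (by omega) I.card J.card _ _ ?_ rfl, mul_zero]
        have hI := Finset.card_le_univ I
        have hJ := Finset.card_le_univ J
        rw [Fintype.card_fin] at hI hJ
        omega
      · rfl

theorem primOp_comp {r s k l : ℕ} (x : Fin r → A) (y : Fin s → A) (z : A)
    (e : Fin k ↪o Fin r) (f : Fin l ↪o Fin s) (hk : k = r) (hl : l = s) :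
    primOp k l (fun i => x (e i)) (fun j => y (f j)) z = primOp r s x y z := by
  subst hk hl
  have he : e = RelEmbedding.refl _ :=
    (Finset.orderEmbOfFin_unique' (Finset.card_fin _) fun _ => Finset.mem_univ _).trans
      (Finset.orderEmbOfFin_unique' (Finset.card_fin _) fun _ => Finset.mem_univ _).symm
  have hf : f = RelEmbedding.refl _ :=
    (Finset.orderEmbOfFin_unique' (Finset.card_fin _) fun _ => Finset.mem_univ _).trans
      (Finset.orderEmbOfFin_unique' (Finset.card_fin _) fun _ => Finset.mem_univ _).symm
  subst he hf
  rfl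

/-- The defining identity of the primitive operations. -/
theorem primOp_identity (r s : ℕ) (x : Fin r → A) (y : Fin s → A) (z : A) :
    (leftProd x * leftProd y) * z - leftProd x * (leftProd y * z) =
      ∑ I : Finset (Fin r), ∑ J : Finset (Fin s),
        (leftProd (subseq x Iᶜ) * leftProd (subseq y Jᶜ)) *
          primOp I.card J.card (subseq x I) (subseq y J) z := by
  have hlp : ∀ (k : ℕ) (w : Fin k → A), k = 0 → leftProd w = 1 := by
    rintro k w rfl
    simp [leftProd]
  have key : ∀ (I : Finset (Fin r)) (J : Finset (Fin s)),
      (leftProd (subseq x Iᶜ) * leftProd (subseq y Jᶜ)) *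
          primOp I.card J.card (subseq x I) (subseq y J) z =
        (if _h : I.card + J.card < r + s then
          (leftProd (subseq x Iᶜ) * leftProd (subseq y Jᶜ)) *
            primOp I.card J.card (subseq x I) (subseq y J) z
        else 0) + if I = Finset.univ then (if J = Finset.univ then primOp r s x y z else 0)
          else 0 := by
    intro I J
    have hI := Finset.card_le_univ I
    have hJ := Finset.card_le_univ J
    have hI' := Finset.card_eq_iff_eq_univ I
    have hJ' := Finset.card_eq_iff_eq_univ J
    rw [Fintype.card_fin] at hI hJ hI' hJ'
    by_cases h : I = Finset.univ ∧ J = Finset.univ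
    · have hIc := hI'.mpr h.1
      have hJc := hJ'.mpr h.2
      rw [dif_neg (by omega), if_pos h.1, if_pos h.2, zero_add,
        hlp _ (subseq x Iᶜ) (by simp [h.1]), hlp _ (subseq y Jᶜ) (by simp [h.2]), one_mul,
        one_mul]
      exact primOp_comp x y z (I.orderEmbOfFin rfl) (J.orderEmbOfFin rfl) hIc hJc
    · have hlt : I.card + J.card < r + s := by
        by_contra hge
        exact h ⟨hI'.mp (by omega), hJ'.mp (by omega)⟩
      rw [dif_pos hlt]
      by_cases h1 : I = Finset.univ
      · rw [if_pos h1, if_neg (fun h2 => h ⟨h1, h2⟩), add_zero]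
      · rw [if_neg h1, add_zero]
  rw [Finset.sum_congr rfl fun I _ => Finset.sum_congr rfl fun J _ => key I J]
  simp only [Finset.sum_add_distrib, Finset.sum_ite_irrel, Finset.sum_ite_eq', Finset.mem_univ, if_true,
    Finset.sum_const_zero]
  rw [primOp]
  abel

end PrimitiveOperations

end MagnusLoop

open MagnusLoop

/-! The statement is first proved when all `m + n + 1` arguments are distinct letters. The general
case follows by substituting letters for letters: this is a ring homomorphism that preserves degree
and commutes with deviations (`map_deviationP`) and with primitive operations (`map_primOp`).

For distinct letters, take a monomial `w` of degree at most `m + n + 1`. If `w` omits a letter `s`,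
its coefficient does not change when the argument `1 + s'` is replaced by `1`. The deviation is then
`1` (`seqDeviation_eq_one`), while `p` has no term at `w`, since each of its monomials contains
every letter. If `w` omits no letter, then by its degree it contains each exactly once. So it
suffices to compute modulo monomials with repeated letters.

Modulo these monomials, two series whose terms all contain `z` have product zero. Hence loop
division linearizes: if `A`, `B`, `C` are `1 + f`, `1 + g`, `1 + h` with `f`, `g`, `h` involving
`z`, then `(AB) \ C = 1 + (h - f - g)` (`multilinearTrunc_ldiv_mul`).

The product of the series `1 + x'` over a list is the sum of the left-normed products of all its
subsequences. Summing the defining identity of `p` over subsequences of two lists `l` and `k` gives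
a sum over disjoint pairs of subsequences. Overlapping pairs vanish in the truncation, so the sum
factors, and the associator of the products over `l` and `k` with `1 + z'` is `1 + ∑ p(s; t; z)`,
with `s` and `t` running over all subsequences of `l` and `k` (`multilinearTrunc_loopAssociator`).
Each further deviation takes an additive defect in one list, which keeps only the subsequences
containing the newly appended letter (`subSumNonempty_concat`). After all steps only `p(x; y; z)`
with the full sequences remains. -/

namespace MagnusLoop

universe u v w

/-! ### Sums over subsequences of a list -/

section SubsequenceSums

variable {α : Type u} {M : Type v}

/-- The sum of `F` over all subsequences of a list. -/
def subSum [AddCommMonoid M] : (List α → M) → List α → M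
  | F, [] => F []
  | F, a :: l => subSum F l + subSum (fun s => F (a :: s)) l

/-- The sum of `F` over all decompositions of a list into complementary subsequences. -/
def splitSum [AddCommMonoid M] : (List α → List α → M) → List α → M
  | F, [] => F [] []
  | F, a :: l => splitSum (fun s t => F (a :: s) t) l + splitSum (fun s t => F s (a :: t)) l

section AddCommMonoid

variable [AddCommMonoid M]

theorem subSum_congr {F G : List α → M} (h : ∀ s, F s = G s) (l : List α) :
    subSum F l = subSum G l := by rw [funext h]

theorem splitSum_congr {F G : List α → List α → M} (h : ∀ s t, F s t = G s t) (l : List α) :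
    splitSum F l = splitSum G l := by rw [funext fun s => funext (h s)]

theorem subSum_add (F G : List α → M) (l : List α) :
    subSum (fun s => F s + G s) l = subSum F l + subSum G l := by
  induction l generalizing F G with
  | nil => rfl
  | cons a l ih => simp only [subSum, ih]; abel

theorem subSum_zero (l : List α) : subSum (fun _ : List α => (0 : M)) l = 0 := by
  induction l with
  | nil => rfl
  | cons a l ih => simp only [subSum, ih, add_zero]

theorem map_subSum {N : Type w} [AddCommMonoid N] (φ : M →+ N) (F : List α → M) (l : List α) :
    φ (subSum F l) = subSum (fun s => φ (F s)) l := by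
  induction l generalizing F with
  | nil => rfl
  | cons a l ih => simp only [subSum, map_add, ih]

theorem map_splitSum {N : Type w} [AddCommMonoid N] (φ : M →+ N) (F : List α → List α → M)
    (l : List α) : φ (splitSum F l) = splitSum (fun s t => φ (F s t)) l := by
  induction l generalizing F with
  | nil => rfl
  | cons a l ih => simp only [splitSum, map_add, ih]

theorem splitSum_map {β : Type w} (f : β → α) (F : List α → List α → M) (l : List β) :
    splitSum F (l.map f) = splitSum (fun s t => F (s.map f) (t.map f)) l := by
  induction l generalizing F with
  | nil => rfl
  | cons a l ih => simp only [List.map_cons, splitSum, ih]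

theorem subSum_concat (F : List α → M) (l : List α) (a : α) :
    subSum F (l ++ [a]) = subSum F l + subSum (fun s => F (s ++ [a])) l := by
  induction l generalizing F with
  | nil => rfl
  | cons b l ih => simp only [List.cons_append, subSum, ih]; abel

theorem subSum_comm {β : Type w} (F : List α → List β → M) (l : List α) (k : List β) :
    subSum (fun s => subSum (fun t => F s t) k) l =
      subSum (fun t => subSum (fun s => F s t) l) k := by
  induction l generalizing F with
  | nil => rfl
  | cons a l ih => simp only [subSum, ih, subSum_add]

theorem subSum_splitSum_comm {β : Type w} (F : List α → List β → List β → M) (l : List α)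
    (k : List β) :
    subSum (fun s => splitSum (fun t t' => F s t t') k) l =
      splitSum (fun t t' => subSum (fun s => F s t t') l) k := by
  induction k generalizing F with
  | nil => rfl
  | cons a k ih => simp only [splitSum, subSum_add, ih]

/-- If `F` vanishes on pairs of sequences with a common entry, decompositions of subsequences
may be replaced by pairs of subsequences. -/
theorem subSum_splitSum (F : List α → List α → M)
    (hF : ∀ s t a, a ∈ s → a ∈ t → F s t = 0) (l : List α) :
    subSum (fun r => splitSum F r) l = subSum (fun s => subSum (fun t => F s t) l) l := by
  induction l generalizing F with
  | nil => rfl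
  | cons a l ih =>
    -- Independent choices put `a` in neither sequence, in one of them, or in both; decomposing a
    -- subsequence allows all but the last.
    have h0 : ∀ s t, F (a :: s) (a :: t) = 0 := fun s t => hF _ _ a (by simp) (by simp)
    simp only [subSum, splitSum, subSum_add, h0, subSum_zero, add_zero]
    rw [ih F hF, ih (fun s t => F (a :: s) t) fun s t b hs ht =>
        hF _ _ b (List.mem_cons_of_mem _ hs) ht, ih (fun s t => F s (a :: t)) fun s t b hs ht =>
        hF _ _ b hs (List.mem_cons_of_mem _ ht)]
    abel

/-- The sum over complementary filtrations of a list without repetitions. -/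
theorem sum_powerset_filter [DecidableEq α] (G : List α → List α → M) (l : List α)
    (hl : l.Nodup) :
    ∑ I ∈ l.toFinset.powerset, G (l.filter (· ∉ I)) (l.filter (· ∈ I)) = splitSum G l := by
  induction l generalizing G with
  | nil => simp [splitSum]
  | cons a l ih =>
    obtain ⟨ha, hl⟩ := List.nodup_cons.mp hl
    have ha' : a ∉ l.toFinset := by simpa using ha
    rw [List.toFinset_cons, Finset.sum_powerset_insert ha', splitSum, ← ih _ hl, ← ih _ hl]
    congr 1
    · refine Finset.sum_congr rfl fun I hI => ?_
      have : a ∉ I := fun h => ha' (Finset.mem_powerset.mp hI h)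
      simp [this]
    · refine Finset.sum_congr rfl fun I hI => ?_
      have h1 : ∀ b ∈ l, (b ∈ insert a I ↔ b ∈ I) := fun b hb => by
        have : b ≠ a := fun h => ha (h ▸ hb)
        simp [this]
      have h2 : l.filter (· ∉ insert a I) = l.filter (· ∉ I) :=
        List.filter_congr fun b hb => by simp only [h1 b hb]
      have h3 : l.filter (· ∈ insert a I) = l.filter (· ∈ I) :=
        List.filter_congr fun b hb => by simp only [h1 b hb]
      rw [List.filter_cons, List.filter_cons, h2, h3]
      simp

end AddCommMonoid

/-- The sum of `F` over all nonempty subsequences of a list. -/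
def subSumNonempty [AddCommGroup M] (F : List α → M) (l : List α) : M := subSum F l - F []

theorem subSumNonempty_singleton [AddCommGroup M] (F : List α → M) (a : α) :
    subSumNonempty F [a] = F [a] := by
  simp [subSumNonempty, subSum]

/-- The subtracted terms cancel the subsequences without `a` and the subsequence `[a]`; what remains
contains `a` and a nonempty part of `l`. This is the combinatorial form of one deviation step. -/
theorem subSumNonempty_concat [AddCommGroup M] (F : List α → M) (l : List α) (a : α) :
    subSumNonempty F (l ++ [a]) - subSumNonempty F l - subSumNonempty F [a] =
      subSumNonempty (fun s => F (s ++ [a])) l := by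
  rw [subSumNonempty_singleton]
  simp only [subSumNonempty, subSum_concat, List.nil_append]
  abel

end SubsequenceSums

/-! ### Primitive operations on lists -/

section PrimitiveOperationsOnLists

variable {A : Type u} [NonAssocRing A]

theorem ofFn_subseq {X : Type v} {r : ℕ} (x : Fin r → X) (I : Finset (Fin r)) :
    List.ofFn (subseq x I) = ((List.finRange r).filter (· ∈ I)).map x := by
  have h : (List.finRange r).filter (· ∈ I) = I.sort (· ≤ ·) :=
    ((List.sortedLT_finRange r).pairwise.filter _).sortedLT.eq_of_mem_iff I.sortedLT_sort (by simp)
  rw [h, ← Finset.listMap_orderEmbOfFin_finRange I rfl, List.map_map, List.ofFn_eq_map]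
  rfl

/-- Turns the sums over sets of places in `primOp_identity` into a sum recursive in the list, to
which induction applies. -/
theorem sum_subseq_eq_splitSum {M : Type v} [AddCommMonoid M] {X : Type w} (G : List X → List X → M)
    {r : ℕ} (x : Fin r → X) :
    ∑ I : Finset (Fin r), G (List.ofFn (subseq x Iᶜ)) (List.ofFn (subseq x I)) =
      splitSum G (List.ofFn x) := by
  rw [List.ofFn_eq_map, splitSum_map, ← sum_powerset_filter _ _ (List.nodup_finRange r)]
  simp only [List.toFinset_finRange, Finset.powerset_univ, ofFn_subseq, Finset.mem_compl]

/-- The left-normed product of a list. -/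
def listProd (l : List A) : A := l.foldl (· * ·) 1

theorem listProd_concat (l : List A) (a : A) : listProd (l ++ [a]) = listProd l * a := by
  simp [listProd]

/-- The primitive operations with arguments given as lists. -/
def primList (l k : List A) (z : A) : A := primOp l.length k.length l.get k.get z

theorem primList_ofFn {r s : ℕ} (x : Fin r → A) (y : Fin s → A) (z : A) :
    primList (List.ofFn x) (List.ofFn y) z = primOp r s x y z := by
  have h := primOp_comp x y z (Fin.castOrderIso (List.length_ofFn (f := x))).toOrderEmbedding
    (Fin.castOrderIso (List.length_ofFn (f := y))).toOrderEmbedding (by simp) (by simp)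
  rw [← h, primList]
  congr 1 <;> ext i <;> simp <;> rfl

theorem primList_nil_left (k : List A) (z : A) : primList [] k z = 0 :=
  primOp_eq_zero _ _ _ _ _ (Or.inl rfl)

theorem primList_nil_right (l : List A) (z : A) : primList l [] z = 0 :=
  primOp_eq_zero _ _ _ _ _ (Or.inr rfl)

theorem primList_identity (l k : List A) (z : A) :
    (listProd l * listProd k) * z - listProd l * (listProd k * z) =
      splitSum (fun l₁ l₂ => splitSum (fun k₁ k₂ =>
        (listProd l₁ * listProd k₁) * primList l₂ k₂ z) k) l := by
  have h := primOp_identity l.length k.length l.get k.get z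
  simp only [leftProd, List.ofFn_get, ← primList_ofFn] at h
  rw [listProd, listProd, h]
  conv_rhs => rw [← List.ofFn_get l, ← sum_subseq_eq_splitSum]
  refine Finset.sum_congr rfl fun I _ => ?_
  conv_rhs => rw [← List.ofFn_get k, ← sum_subseq_eq_splitSum]
  rfl

theorem map_leftProd {B : Type v} [NonAssocRing B] (φ : A →+* B) {r : ℕ} (x : Fin r → A) :
    φ (leftProd x) = leftProd fun i => φ (x i) := by
  have h : ∀ (l : List A) (a : A),
      φ (l.foldl (· * ·) a) = (l.map φ).foldl (· * ·) (φ a) := fun l => by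
    induction l with
    | nil => exact fun a => rfl
    | cons b l ih => exact fun a => by simp [ih]
  rw [leftProd, leftProd, h, map_one, List.map_ofFn]
  rfl

theorem map_primOp {B : Type v} [NonAssocRing B] (φ : A →+* B) (r s : ℕ) (x : Fin r → A)
    (y : Fin s → A) (z : A) :
    φ (primOp r s x y z) = primOp r s (fun i => φ (x i)) (fun j => φ (y j)) (φ z) := by
  induction hn : r + s using Nat.strong_induction_on generalizing r s with
  | _ n ih =>
    rw [primOp, primOp, map_sub, map_sub, map_sum]
    simp only [map_mul, map_leftProd]
    congr 1
    refine Finset.sum_congr rfl fun I _ => ?_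
    rw [map_sum]
    refine Finset.sum_congr rfl fun J _ => ?_
    split_ifs with h
    · rw [map_mul, map_mul, map_leftProd, map_leftProd, ih _ (hn ▸ h) _ _ _ _ rfl]
      rfl
    · exact map_zero φ

end PrimitiveOperationsOnLists

/-! ### Multidegrees -/

/-- The letters of a bracketed word, with multiplicities. -/
def wordLetters {V : Type u} : FreeMagma V → Multiset V
  | .of v => {v}
  | .mul s t => wordLetters s + wordLetters t

namespace Monomial

variable {V : Type u}

/-- The letters of a monomial, with multiplicities. -/
def letters (w : Monomial V) : Multiset V := WithOne.recOneCoe 0 wordLetters w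

@[simp] theorem letters_one : letters (1 : Monomial V) = 0 := rfl

@[simp] theorem letters_of (v : V) : letters (FreeMagma.of v : Monomial V) = {v} := rfl

theorem letters_mul (a b : Monomial V) : letters (a * b) = letters a + letters b := by
  cases a using WithOne.recOneCoe with
  | one => rw [one_mul, letters_one, zero_add]
  | coe a =>
    cases b using WithOne.recOneCoe with
    | one => rw [mul_one, letters_one, add_zero]
    | coe b => rfl

theorem card_letters (w : Monomial V) : Multiset.card (letters w) = w.degree := by
  cases w using WithOne.recOneCoe with
  | one => rfl
  | coe w =>
    change Multiset.card (wordLetters w) = w.length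
    induction w using FreeMagma.rec with
    | of v => rfl
    | mul s t hs ht => rw [wordLetters, Multiset.card_add, hs, ht]; rfl

end Monomial

namespace NAPowerSeries

open Monomial

variable {V : Type u} {R : Type v} [CommRing R]

/-- `f` is multihomogeneous: only monomials with letters `μ` occur in it. -/
def IsMultihomogeneous (f : NAPowerSeries V R) (μ : Multiset V) : Prop :=
  ∀ w, coeff w f ≠ 0 → letters w = μ

@[simp] theorem coeff_sub (w : Monomial V) (f g : NAPowerSeries V R) :
    coeff w (f - g) = coeff w f - coeff w g := rfl

/-- The coefficient as an additive map. -/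
def coeffHom (R : Type v) [CommRing R] (w : Monomial V) : NAPowerSeries V R →+ R where
  toFun := coeff w
  map_zero' := rfl
  map_add' _ _ := rfl

theorem coeff_sum {ι : Type*} (w : Monomial V) (s : Finset ι) (f : ι → NAPowerSeries V R) :
    coeff w (∑ i ∈ s, f i) = ∑ i ∈ s, coeff w (f i) := map_sum (coeffHom R w) f s

theorem exists_coeff_ne_zero_of_mul {w : Monomial V} {f g : NAPowerSeries V R}
    (h : coeff w (f * g) ≠ 0) : ∃ a b, a * b = w ∧ coeff a f ≠ 0 ∧ coeff b g ≠ 0 := by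
  by_contra! hc
  refine h ?_
  rw [coeff_mul]
  refine List.sum_eq_zero fun c hcm => ?_
  obtain ⟨p, hp, rfl⟩ := List.mem_map.mp hcm
  by_cases ha : coeff p.1 f = 0
  · rw [ha, zero_mul]
  · rw [hc _ _ ((mem_factorizations w p).mp hp) ha, mul_zero]

theorem coeff_one_coe_ne {w : Monomial V} (h : w ≠ 1) :
    coeff w (1 : NAPowerSeries V R) = 0 := if_neg h

theorem coeff_one_X (v : V) : coeff 1 (X R v) = 0 := if_neg WithOne.one_ne_coe

namespace IsMultihomogeneous

variable {f g : NAPowerSeries V R} {μ ν : Multiset V}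

theorem zero (μ : Multiset V) : IsMultihomogeneous (0 : NAPowerSeries V R) μ :=
  fun _ h => absurd rfl h

theorem one : IsMultihomogeneous (1 : NAPowerSeries V R) 0 := fun w h => by
  by_contra hw
  exact h (coeff_one_coe_ne fun h1 => hw (h1 ▸ letters_one))

theorem X (v : V) : IsMultihomogeneous (X R v) {v} := fun w h => by
  by_contra hw
  exact h (if_neg fun h1 => hw (by rw [h1, letters_of]))

theorem sub (hf : IsMultihomogeneous f μ) (hg : IsMultihomogeneous g μ) :
    IsMultihomogeneous (f - g) μ := fun w h => by
  by_cases h1 : coeff w f = 0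
  · refine hg w fun h2 => h ?_
    rw [coeff_sub, h1, h2, sub_zero]
  · exact hf w h1

theorem sum {ι : Type*} (s : Finset ι) (F : ι → NAPowerSeries V R)
    (h : ∀ i ∈ s, IsMultihomogeneous (F i) μ) : IsMultihomogeneous (∑ i ∈ s, F i) μ :=
  fun w hw => by
    rw [coeff_sum] at hw
    obtain ⟨i, hi, hiw⟩ := Finset.exists_ne_zero_of_sum_ne_zero hw
    exact h i hi w hiw

theorem mul (hf : IsMultihomogeneous f μ) (hg : IsMultihomogeneous g ν) :
    IsMultihomogeneous (f * g) (μ + ν) := fun w h => by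
  obtain ⟨a, b, rfl, ha, hb⟩ := exists_coeff_ne_zero_of_mul h
  rw [letters_mul, hf a ha, hg b hb]

theorem listProd (l : List (NAPowerSeries V R × Multiset V))
    (h : ∀ p ∈ l, IsMultihomogeneous p.1 p.2) :
    IsMultihomogeneous (listProd (l.map Prod.fst)) (l.map Prod.snd).sum := by
  induction l using List.reverseRecOn with
  | nil => exact one
  | append_singleton l p ih =>
    rw [List.map_append, List.map_append, List.sum_append, List.map_singleton, listProd_concat]
    refine (ih fun q hq => h q (List.mem_append_left _ hq)).mul ?_
    simpa using h p (by simp)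

theorem leftProd {r : ℕ} {x : Fin r → NAPowerSeries V R} {μ : Fin r → Multiset V}
    (h : ∀ i, IsMultihomogeneous (x i) (μ i)) :
    IsMultihomogeneous (leftProd x) (∑ i, μ i) := by
  have := listProd (List.ofFn fun i => (x i, μ i)) (by simpa using h)
  rwa [List.map_ofFn, List.map_ofFn, List.sum_ofFn] at this

theorem sum_orderEmbOfFin {r : ℕ} (μ : Fin r → Multiset V) (I : Finset (Fin r)) :
    ∑ i, μ (I.orderEmbOfFin rfl i) = ∑ i ∈ I, μ i := by
  conv_rhs => rw [← Finset.map_orderEmbOfFin_univ I rfl, Finset.sum_map]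
  rfl

/-- Every term of the recursion uses each argument exactly once, since a subsequence and its
complement share out the arguments. -/
theorem primOp {r s : ℕ} {x : Fin r → NAPowerSeries V R} {y : Fin s → NAPowerSeries V R}
    {z : NAPowerSeries V R} {μ : Fin r → Multiset V} {ν : Fin s → Multiset V} {ρ : Multiset V}
    (hx : ∀ i, IsMultihomogeneous (x i) (μ i)) (hy : ∀ j, IsMultihomogeneous (y j) (ν j))
    (hz : IsMultihomogeneous z ρ) :
    IsMultihomogeneous (primOp r s x y z) (∑ i, μ i + ∑ j, ν j + ρ) := by
  induction hn : r + s using Nat.strong_induction_on generalizing r s with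
  | _ n ih =>
    rw [MagnusLoop.primOp]
    refine ((((leftProd hx).mul (leftProd hy)).mul hz).sub ?_).sub ?_
    · rw [add_assoc]
      exact (leftProd hx).mul ((leftProd hy).mul hz)
    · refine sum _ _ fun I _ => sum _ _ fun J _ => ?_
      split_ifs with h
      · have h1 := ((leftProd (x := subseq x Iᶜ) fun i => hx _).mul
          (leftProd (x := subseq y Jᶜ) fun i => hy _)).mul
          (ih _ (hn ▸ h) (x := subseq x I) (y := subseq y J) (fun i => hx _) (fun j => hy _) rfl)
        rw [sum_orderEmbOfFin, sum_orderEmbOfFin, sum_orderEmbOfFin, sum_orderEmbOfFin] at h1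
        rw [← Finset.sum_add_sum_compl I μ, ← Finset.sum_add_sum_compl J ν]
        convert h1 using 1
        abel
      · exact zero _

end IsMultihomogeneous

theorem primOp_X_isMultihomogeneous {r s : ℕ} (x : Fin r → V) (y : Fin s → V) (z : V) :
    IsMultihomogeneous (primOp r s (fun i => X R (x i)) (fun j => X R (y j)) (X R z))
      (∑ i, {x i} + ∑ j, {y j} + {z}) :=
  .primOp (fun i => .X (x i)) (fun j => .X (y j)) (.X z)

theorem coeff_primOp_X_of_degree_ne {r s : ℕ} (x : Fin r → V) (y : Fin s → V) (z : V)
    {w : Monomial V} (hw : w.degree ≠ r + s + 1) :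
    coeff w (primOp r s (fun i => X R (x i)) (fun j => X R (y j)) (X R z)) = 0 := by
  by_contra h
  refine hw ?_
  rw [← card_letters, primOp_X_isMultihomogeneous x y z w h]
  simp

/-! ### Non-vanishing of the primitive operations -/

theorem ofMonomial_mul (a b : Monomial V) :
    ofMonomial R a * ofMonomial R b = ofMonomial R (a * b) := by
  classical
  ext w
  rw [coeff_mul, List.sum_map_eq_nsmul_single (a, b)]
  · change _ • ((if a = a then (1 : R) else 0) * (if b = b then 1 else 0)) =
      if w = a * b then 1 else 0
    rw [if_pos rfl, if_pos rfl, mul_one, nsmul_one,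
      @List.Nodup.count _ instBEqOfDecidableEq _ _ _ (nodup_factorizations w)]
    simp only [mem_factorizations, eq_comm]
    split_ifs <;> simp
  · rintro ⟨c, d⟩ h -
    change (if c = a then (1 : R) else 0) * (if d = b then 1 else 0) = 0
    split_ifs with hc hd
    · exact absurd (by rw [hc, hd]) h
    all_goals simp

theorem leftProd_X_eq_ofMonomial {r : ℕ} (hr : r ≠ 0) (x : Fin r → V) :
    ∃ s : FreeMagma V, leftProd (fun i => X R (x i)) = ofMonomial R (s : Monomial V) := by
  have h : ∀ l : List V, l ≠ [] →
      ∃ s : FreeMagma V, listProd (l.map (X R)) = ofMonomial R (s : Monomial V) := fun l => by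
    induction l using List.reverseRecOn with
    | nil => exact fun h => absurd rfl h
    | append_singleton l v ih =>
      intro _
      rw [List.map_append, List.map_singleton, listProd_concat]
      rcases eq_or_ne l [] with rfl | h
      · exact ⟨FreeMagma.of v, one_mul _⟩
      · obtain ⟨s, hs⟩ := ih h
        exact ⟨s * FreeMagma.of v, by rw [hs, X, ofMonomial_mul]; rfl⟩
  obtain ⟨s, hs⟩ := h (List.ofFn x) (by simpa using hr)
  refine ⟨s, ?_⟩
  rw [← hs, List.map_ofFn]
  rfl

/-- The monomial `(uv)z` occurs in `p(u; v; z)` with coefficient `1`. -/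
theorem primOp_X_ne_zero [Nontrivial R] {r s : ℕ} (hr : r ≠ 0) (hs : s ≠ 0) (x : Fin r → V)
    (y : Fin s → V) (z : V) :
    primOp r s (fun i => X R (x i)) (fun j => X R (y j)) (X R z) ≠ 0 := by
  obtain ⟨a, ha⟩ := leftProd_X_eq_ofMonomial (R := R) hr x
  obtain ⟨b, hb⟩ := leftProd_X_eq_ofMonomial (R := R) hs y
  have hdeg : Monomial.degree ((a * b * FreeMagma.of z : FreeMagma V) : Monomial V) = r + s + 1 := by
    have h1 := (IsMultihomogeneous.leftProd (x := fun i => X R (x i)) fun i => .X (x i)) a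
      (by rw [ha]; exact (if_pos rfl).trans_ne one_ne_zero)
    have h2 := (IsMultihomogeneous.leftProd (x := fun j => X R (y j)) fun j => .X (y j)) b
      (by rw [hb]; exact (if_pos rfl).trans_ne one_ne_zero)
    rw [WithOne.coe_mul, WithOne.coe_mul, ← card_letters, letters_mul, letters_mul, h1, h2]
    simp
  suffices h : coeff ((a * b * FreeMagma.of z : FreeMagma V) : Monomial V)
      (primOp r s (fun i => X R (x i)) (fun j => X R (y j)) (X R z)) = 1 by
    intro h0
    rw [h0, coeff_zero] at h
    exact zero_ne_one h
  rw [primOp, ha, hb, X, ofMonomial_mul, ofMonomial_mul, ofMonomial_mul, ofMonomial_mul,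
    coeff_sub, coeff_sub, coeff_sum, Finset.sum_eq_zero, sub_zero]
  · have hne : ((a * b * FreeMagma.of z : FreeMagma V) : Monomial V) ≠
        (a : Monomial V) * ((b : Monomial V) * (FreeMagma.of z : Monomial V)) := fun h => by
      have h' : a * b * FreeMagma.of z = a * (b * FreeMagma.of z) := WithOne.coe_injective h
      injection h' with _ h2
      cases h2
    have h1 : coeff ((a * b * FreeMagma.of z : FreeMagma V) : Monomial V) (ofMonomial R
        ((a : Monomial V) * (b : Monomial V) * (FreeMagma.of z : Monomial V))) = 1 := if_pos rfl
    have h2 : coeff ((a * b * FreeMagma.of z : FreeMagma V) : Monomial V) (ofMonomial R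
        ((a : Monomial V) * ((b : Monomial V) * (FreeMagma.of z : Monomial V)))) = 0 := if_neg hne
    rw [h1, h2, sub_zero]
  · intro I _
    rw [coeff_sum, Finset.sum_eq_zero]
    intro J _
    split_ifs with h
    -- The correction terms do not contain `(ab)z`. Here `p` lives in degree `|I| + |J| + 1 < r + s
    -- + 1`, so neither the whole word nor `1` occurs in it. The remaining factorization needs the
    -- letter `z` in `p`, hence `I` and `J` empty, where `p = 0`.
    · rw [coeff_mul_mul]
      have hp : ∀ w : Monomial V, w.degree ≠ I.card + J.card + 1 → coeff w (primOp I.card J.card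
          (subseq (fun i => X R (x i)) I) (subseq (fun j => X R (y j)) J) (X R z)) = 0 :=
        fun w hw => coeff_primOp_X_of_degree_ne (fun i => x (I.orderEmbOfFin rfl i))
          (fun j => y (J.orderEmbOfFin rfl j)) z hw
      rw [← X, hp _ (by rw [hdeg]; omega), hp 1 (Nat.succ_ne_zero _).symm, mul_zero, mul_zero,
        zero_add, zero_add]
      by_cases hI : I.card = 0
      · rw [primOp_eq_zero _ _ _ _ _ (Or.inl hI), coeff_zero, mul_zero]
      · rw [hp _ (fun h1 => hI ?_), mul_zero]
        have h2 : (1 : ℕ) = I.card + J.card + 1 := h1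
        omega
    · rfl

end NAPowerSeries

/-! ### Deviations of infinite sequences -/

section Sequences

variable {L : Type u}

/-- The sequence `e` with the entries at places `k` and `k + 1` replaced by the single entry `t`. -/
def contractAt (k : ℕ) (t : L) (e : ℕ → L) : ℕ → L :=
  fun i => if i < k then e i else if i = k then t else e (i + 1)

theorem contractAt_of_lt {k i : ℕ} (h : i < k) (t : L) (e : ℕ → L) :
    contractAt k t e i = e i := if_pos h

@[simp] theorem contractAt_self (k : ℕ) (t : L) (e : ℕ → L) : contractAt k t e k = t := by
  simp [contractAt]

theorem contractAt_of_gt {k i : ℕ} (h : k < i) (t : L) (e : ℕ → L) :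
    contractAt k t e i = e (i + 1) := by
  rw [contractAt, if_neg (by omega), if_neg (by omega)]

variable [Loop L]

/-- The deviation of the beginning of a sequence; the list consists of the indices, the last
index being its head. -/
def seqDeviation : List ℕ → (ℕ → L) → L
  | [], e => loopAssociator (e 0) (e 1) (e 2)
  | k :: α, e =>
      Loop.ldiv (seqDeviation α (contractAt k (e k) e) * seqDeviation α (contractAt k (e (k + 1)) e))
        (seqDeviation α (contractAt k (e k * e (k + 1)) e))

/-- With infinite sequences contraction does not change the type, so the later inductions need no
casts between the lengths `n + 3`. -/
theorem deviation_eq_seqDeviation (n : ℕ) (α : (i : Fin n) → Fin ((i : ℕ) + 3)) (e : ℕ → L) :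
    deviation n α (fun i => e i) = seqDeviation (List.ofFn fun i => (α i : ℕ)).reverse e := by
  induction n generalizing e with
  | zero => rfl
  | succ n ih =>
    have h : ∀ (k : Fin (n + 3)) (t : L),
        k.castSucc.contractNth (fun _ _ => t) (fun i : Fin (n + 1 + 3) => e i) =
          fun i : Fin (n + 3) => contractAt k t e i := fun k t => by
      ext i
      simp only [Fin.contractNth, contractAt, Fin.val_castSucc, Fin.val_succ]
    rw [List.ofFn_succ_last, List.reverse_append, List.reverse_singleton, List.singleton_append,
      seqDeviation, deviation]
    simp only [h, ih]
    rfl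

theorem ldiv_self (a : L) : Loop.ldiv a a = 1 := by
  simpa using Loop.ldiv_mul a 1

/-- If the entry `1` lies outside the contracted pair, all three inner deviations are `1`. If it
belongs to the pair, one inner deviation is `1` and the other two coincide. The condition `hα` is
the admissible range of the indices: `k` is preceded by `r.length` earlier ones. -/
theorem seqDeviation_eq_one (α : List ℕ) (e : ℕ → L) (i : ℕ) (hi : i < α.length + 3)
    (hα : ∀ l k r, α = l ++ k :: r → k < r.length + 3) (h : e i = 1) :
    seqDeviation α e = 1 := by
  induction α generalizing e i with
  | nil =>
    have : i = 0 ∨ i = 1 ∨ i = 2 := by simp at hi; omega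
    rcases this with rfl | rfl | rfl <;>
      simp only [seqDeviation, loopAssociator, h, one_mul, mul_one, ldiv_self]
  | cons k α ih =>
    have hk : k < α.length + 3 := hα [] k α rfl
    have ih' := fun e i hi h => ih e i hi (fun l k' r hr => hα (k :: l) k' r (by rw [hr]; rfl)) h
    rw [List.length_cons] at hi
    have h1 : seqDeviation α (contractAt k 1 e) = 1 := ih' _ k hk (contractAt_self _ _ _)
    rw [seqDeviation]
    rcases lt_trichotomy i k with hik | rfl | hik
    · have hall : ∀ t, seqDeviation α (contractAt k t e) = 1 := fun t =>
        ih' _ i (by omega) (by rw [contractAt_of_lt hik, h])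
      rw [hall, hall, hall, one_mul, ldiv_self]
    · rw [h, one_mul, h1, one_mul, ldiv_self]
    · rcases Nat.lt_or_ge (k + 1) i with hik' | hik'
      · have hall : ∀ t, seqDeviation α (contractAt k t e) = 1 := fun t =>
          ih' _ (i - 1) (by omega)
            (by rw [contractAt_of_gt (by omega), Nat.sub_add_cancel (by omega), h])
        rw [hall, hall, hall, one_mul, ldiv_self]
      · obtain rfl : i = k + 1 := by omega
        rw [h, mul_one, h1, mul_one, ldiv_self]

theorem map_ldiv {K : Type v} [Loop K] (φ : L →* K) (a b : L) :
    φ (Loop.ldiv a b) = Loop.ldiv (φ a) (φ b) := by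
  conv_rhs => rw [← Loop.mul_ldiv a b, map_mul, Loop.ldiv_mul]

theorem map_deviation {K : Type v} [Loop K] (φ : L →* K) (n : ℕ)
    (α : (i : Fin n) → Fin ((i : ℕ) + 3)) (a : Fin (n + 3) → L) :
    φ (deviation n α a) = deviation n α fun i => φ (a i) := by
  induction n with
  | zero => simp only [deviation, loopAssociator, map_ldiv, map_mul]
  | succ n ih =>
    have h : ∀ (k : Fin (n + 3)) (t : L), (fun i => φ (k.castSucc.contractNth (fun _ _ => t) a i)) =
        k.castSucc.contractNth (fun _ _ => φ t) (fun i => φ (a i)) := fun k t => by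
      ext i
      simp only [Fin.contractNth]
      split_ifs <;> rfl
    simp only [deviation, map_ldiv, map_mul, ih, h]

theorem map_deviationP {K : Type v} [Loop K] (φ : L →* K) (m n : ℕ) (x : Fin m → L)
    (y : Fin n → L) (z : L) :
    φ (deviationP m n x y z) = deviationP m n (fun i => φ (x i)) (fun j => φ (y j)) (φ z) := by
  rw [deviationP, map_deviation, deviationP]
  congr 1
  ext j
  split_ifs <;> rfl

/-- The sequence `x_1, …, x_m, y_1, …, y_n, z, z, …`. -/
def blockSeq {m n : ℕ} (x : Fin m → L) (y : Fin n → L) (z : L) : ℕ → L :=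
  fun j => if h : j < m then x ⟨j, h⟩ else if h' : j - m < n then y ⟨j - m, h'⟩ else z

theorem deviationP_succ_eq_seqDeviation (m n : ℕ) (x : Fin (m + 1) → L) (y : Fin (n + 1) → L)
    (z : L) : deviationP (m + 1) (n + 1) x y z =
      seqDeviation (List.replicate n (m + 1) ++ List.replicate m 0) (blockSeq x y z) := by
  have h : (List.ofFn fun i : Fin (m + n) => if (i : ℕ) < m then 0 else m + 1).reverse =
      List.replicate n (m + 1) ++ List.replicate m 0 := by
    rw [List.reverse_eq_iff, List.reverse_append, List.reverse_replicate, List.reverse_replicate]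
    refine List.ext_getElem (by simp) fun i h1 h2 => ?_
    simp only [List.getElem_ofFn, List.getElem_append, List.getElem_replicate, List.length_replicate]
    split_ifs <;> rfl
  rw [← h, deviationP]
  refine (deviation_eq_seqDeviation (m + n) _ (blockSeq x y z)).trans ?_
  congr 3
  ext i
  simp only [Nat.add_sub_cancel]
  split_ifs <;> rfl

end Sequences

/-! ### Truncation of power series -/

namespace NAPowerSeries

variable {V : Type u} {R : Type v} [CommRing R]

/-- A set of monomials closed under taking factors. -/
structure FactorClosed (C : Set (Monomial V)) : Prop where
  left : ∀ {a b}, a * b ∈ C → a ∈ C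
  right : ∀ {a b}, a * b ∈ C → b ∈ C

variable {C : Set (Monomial V)}

/-- The congruence on power series given by equality of the coefficients at the monomials of a
set closed under taking factors. -/
def truncCon (R : Type v) [CommRing R] (hC : FactorClosed C) : RingCon (NAPowerSeries V R) where
  r f g := ∀ w ∈ C, coeff w f = coeff w g
  iseqv := ⟨fun _ _ _ => rfl, fun h w hw => (h w hw).symm, fun h h' w hw =>
    (h w hw).trans (h' w hw)⟩
  add' h h' w hw := by rw [coeff_add, coeff_add, h w hw, h' w hw]
  mul' {f f' g g'} h h' w hw := by
    rw [coeff_mul, coeff_mul]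
    congr 1
    refine List.map_congr_left fun p hp => ?_
    have hp := (mem_factorizations w p).mp hp
    rw [h _ (hC.left (hp ▸ hw)), h' _ (hC.right (hp ▸ hw))]

/-- The truncation map. -/
noncomputable def trunc (R : Type v) [CommRing R] (hC : FactorClosed C) :
    NAPowerSeries V R →+* (truncCon R hC).Quotient where
  toFun f := f
  map_one' := rfl
  map_mul' _ _ := rfl
  map_zero' := rfl
  map_add' _ _ := rfl

theorem trunc_eq_iff (hC : FactorClosed C) {f g : NAPowerSeries V R} :
    trunc R hC f = trunc R hC g ↔ ∀ w ∈ C, coeff w f = coeff w g := RingCon.eq _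

theorem trunc_eq_zero_iff (hC : FactorClosed C) {f : NAPowerSeries V R} :
    trunc R hC f = 0 ↔ ∀ w ∈ C, coeff w f = 0 := by
  rw [← map_zero (trunc R hC), trunc_eq_iff]
  rfl

/-- Since `a` has constant term `1`, the coefficient of `a f` at `st` is that of `f` plus terms in
the coefficients of `f` at `1` and `t`, which are known by induction because `C` contains the
factors of `st`. -/
theorem trunc_left_cancel (hC : FactorClosed C) {a f g : NAPowerSeries V R} (ha : coeff 1 a = 1)
    (h : trunc R hC (a * f) = trunc R hC (a * g)) : trunc R hC f = trunc R hC g := by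
  rw [trunc_eq_iff] at h ⊢
  intro w hw
  have h1 : ∀ w ∈ C, coeff 1 f = coeff 1 g := fun w hw => by
    have := h 1 (hC.left (a := 1) (b := w) (by rwa [one_mul]))
    rwa [coeff_one_mul, coeff_one_mul, ha, one_mul, one_mul] at this
  cases w using WithOne.recOneCoe with
  | one => exact h1 1 hw
  | coe w =>
    induction w using FreeMagma.rec with
    | of v =>
      have := h _ hw
      rw [coeff_of_mul, coeff_of_mul, ha, h1 _ hw, one_mul, one_mul] at this
      exact add_right_cancel this
    | mul s t _ ih =>
      have h2 := h ((s * t : FreeMagma V) : Monomial V) hw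
      have h3 := ih (hC.right (a := (s : Monomial V)) hw)
      rw [coeff_mul_mul, coeff_mul_mul, ha, h1 _ hw, h3, one_mul, one_mul] at h2
      exact add_right_cancel h2

end NAPowerSeries

namespace UnitSeries

open NAPowerSeries

variable {V : Type u} {R : Type v} [CommRing R] {C : Set (Monomial V)}

/-- Reduces the computation of a left quotient modulo the congruence to guessing `f` and multiplying
out. -/
theorem trunc_ldiv (hC : FactorClosed C) {a b : UnitSeries V R} {f : NAPowerSeries V R}
    (h : trunc R hC (a.1 * f) = trunc R hC b.1) :
    trunc R hC (Loop.ldiv a b).1 = trunc R hC f := by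
  refine trunc_left_cancel hC a.2 (Eq.trans ?_ h.symm)
  rw [← val_mul, Loop.mul_ldiv]

theorem trunc_ldiv_congr (hC : FactorClosed C) {a a' b b' : UnitSeries V R}
    (ha : trunc R hC a.1 = trunc R hC a'.1) (hb : trunc R hC b.1 = trunc R hC b'.1) :
    trunc R hC (Loop.ldiv a b).1 = trunc R hC (Loop.ldiv a' b').1 := by
  refine trunc_ldiv hC ?_
  rw [map_mul, ha, hb, ← map_mul, ← val_mul, Loop.mul_ldiv]

theorem trunc_mul_congr (hC : FactorClosed C) {a a' b b' : UnitSeries V R}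
    (ha : trunc R hC a.1 = trunc R hC a'.1) (hb : trunc R hC b.1 = trunc R hC b'.1) :
    trunc R hC (a * b).1 = trunc R hC (a' * b').1 := by
  rw [val_mul, val_mul, map_mul, map_mul, ha, hb]

theorem trunc_seqDeviation_congr (hC : FactorClosed C) (α : List ℕ) (e e' : ℕ → UnitSeries V R)
    (h : ∀ i, trunc R hC (e i).1 = trunc R hC (e' i).1) :
    trunc R hC (seqDeviation α e).1 = trunc R hC (seqDeviation α e').1 := by
  induction α generalizing e e' with
  | nil => 
    exact trunc_ldiv_congr hC (trunc_mul_congr hC (h 0) (trunc_mul_congr hC (h 1) (h 2)))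
      (trunc_mul_congr hC (trunc_mul_congr hC (h 0) (h 1)) (h 2))
  | cons k α ih =>
    have ih' : ∀ t t' : UnitSeries V R, trunc R hC t.1 = trunc R hC t'.1 →
        trunc R hC (seqDeviation α (contractAt k t e)).1 =
          trunc R hC (seqDeviation α (contractAt k t' e')).1 := fun t t' ht =>
      ih _ _ fun i => by
        simp only [contractAt]
        split_ifs
        exacts [h _, ht, h _]
    exact trunc_ldiv_congr hC (trunc_mul_congr hC (ih' _ _ (h _)) (ih' _ _ (h _)))
      (ih' _ _ (trunc_mul_congr hC (h _) (h _)))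

end UnitSeries

/-! ### Subsequence sums in rings and subgroups -/

section SubSumRing

variable {α : Type u}

theorem subSum_sub {M : Type v} [AddCommGroup M] (F G : List α → M) (l : List α) :
    subSum (fun s => F s - G s) l = subSum F l - subSum G l := by
  rw [eq_sub_iff_add_eq, ← subSum_add]
  exact subSum_congr (fun s => sub_add_cancel _ _) l

theorem subSum_mul {A : Type v} [NonAssocRing A] (F : List α → A) (l : List α) (a : A) :
    subSum F l * a = subSum (fun s => F s * a) l := map_subSum (AddMonoidHom.mulRight a) F l

theorem mul_subSum {A : Type v} [NonAssocRing A] (F : List α → A) (l : List α) (a : A) :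
    a * subSum F l = subSum (fun s => a * F s) l := map_subSum (AddMonoidHom.mulLeft a) F l

theorem subSum_mem {M : Type v} [AddCommGroup M] (N : AddSubgroup M) (F : List α → M)
    (h : ∀ s, F s ∈ N) (l : List α) : subSum F l ∈ N := by
  induction l generalizing F with
  | nil => exact h []
  | cons a l ih => exact N.add_mem (ih _ h) (ih _ fun s => h _)

end SubSumRing

/-! ### Power series modulo monomials with repeated letters -/

namespace NAPowerSeries

open Monomial

variable {V : Type u} {R : Type v} [CommRing R]

/-- The monomials without repeated letters. -/
def multilinearMonomials (V : Type u) : Set (Monomial V) := {w | (letters w).Nodup}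

theorem factorClosed_multilinearMonomials : FactorClosed (multilinearMonomials V) where
  left h := by
    rw [multilinearMonomials, Set.mem_ofPred_eq, letters_mul, Multiset.nodup_add] at h
    exact h.1
  right h := by
    rw [multilinearMonomials, Set.mem_ofPred_eq, letters_mul, Multiset.nodup_add] at h
    exact h.2.1

/-- Truncation modulo the monomials with repeated letters. -/
noncomputable abbrev multilinearTrunc (V : Type u) (R : Type v) [CommRing R] :
    NAPowerSeries V R →+* (truncCon R (factorClosed_multilinearMonomials (V := V))).Quotient :=
  trunc R factorClosed_multilinearMonomials

theorem IsMultihomogeneous.multilinearTrunc_eq_zero {f : NAPowerSeries V R} {μ : Multiset V}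
    (hf : IsMultihomogeneous f μ) (hμ : ¬ μ.Nodup) : multilinearTrunc V R f = 0 := by
  rw [trunc_eq_zero_iff]
  intro w hw
  by_contra h
  exact hμ (hf w h ▸ hw)

/-- The power series all of whose monomials contain the letter `z`. -/
def involving (R : Type v) [CommRing R] (z : V) : AddSubgroup (NAPowerSeries V R) where
  carrier := {f | ∀ w, coeff w f ≠ 0 → z ∈ letters w}
  zero_mem' _ h := absurd rfl h
  add_mem' {f g} hf hg w h := by
    by_cases h1 : coeff w f = 0
    · refine hg w fun h2 => h ?_
      rw [coeff_add, h1, h2, add_zero]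
    · exact hf w h1
  neg_mem' {f} hf w h := hf w fun h1 => h (by
    change -coeff w f = 0
    rw [h1, neg_zero])

theorem mul_mem_involving {z : V} (f : NAPowerSeries V R) {g : NAPowerSeries V R}
    (hg : g ∈ involving R z) : f * g ∈ involving R z := fun w h => by
  obtain ⟨a, b, rfl, -, hb⟩ := exists_coeff_ne_zero_of_mul h
  rw [letters_mul]
  exact Multiset.mem_add.mpr (Or.inr (hg b hb))

theorem IsMultihomogeneous.mem_involving {f : NAPowerSeries V R} {μ : Multiset V} {z : V}
    (hf : IsMultihomogeneous f μ) (hz : z ∈ μ) : f ∈ involving R z := fun w h => hf w h ▸ hz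

/-- Every monomial of the product contains `z` twice. This is what makes loop division linear in the
terms involving `z`. -/
theorem multilinearTrunc_mul_eq_zero {z : V} {f g : NAPowerSeries V R}
    (hf : f ∈ involving R z) (hg : g ∈ involving R z) :
    multilinearTrunc V R f * multilinearTrunc V R g = 0 := by
  rw [← map_mul, trunc_eq_zero_iff]
  intro w hw
  by_contra h
  obtain ⟨a, b, rfl, ha, hb⟩ := exists_coeff_ne_zero_of_mul h
  rw [multilinearMonomials, Set.mem_ofPred_eq, letters_mul, Multiset.nodup_add] at hw
  exact Multiset.disjoint_left.mp hw.2.2 (hf a ha) (hg b hb)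

/-- The left-normed product of variables. -/
noncomputable def varProd (R : Type v) [CommRing R] (l : List V) : NAPowerSeries V R :=
  listProd (l.map (X R))

/-- The primitive operation on variables. -/
noncomputable def primVar (R : Type v) [CommRing R] (l k : List V) (z : V) : NAPowerSeries V R :=
  primList (l.map (X R)) (k.map (X R)) (X R z)

theorem varProd_concat (l : List V) (v : V) : varProd R (l ++ [v]) = varProd R l * X R v := by
  rw [varProd, varProd, List.map_append, List.map_singleton, listProd_concat]

theorem varProd_isMultihomogeneous (l : List V) : IsMultihomogeneous (varProd R l) l := by
  induction l using List.reverseRecOn with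
  | nil => exact .one
  | append_singleton l v ih =>
    rw [varProd_concat, ← Multiset.coe_add, Multiset.coe_singleton]
    exact ih.mul (.X v)

theorem primVar_isMultihomogeneous (l k : List V) (z : V) :
    IsMultihomogeneous (primVar R l k z) (l + k + {z}) := by
  have hs : ∀ l : List V, ∑ i : Fin l.length, ({l.get i} : Multiset V) = l := fun l => by
    conv_rhs => rw [← List.ofFn_get l]
    rw [← Multiset.sum_map_singleton (List.ofFn l.get : Multiset V), Multiset.map_coe,
      Multiset.sum_coe, List.map_ofFn, List.sum_ofFn]
    rfl
  have h := primOp_X_isMultihomogeneous (R := R) l.get k.get z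
  rw [hs, hs, ← primList_ofFn] at h
  convert h using 1
  rw [primVar]
  congr 1 <;> exact List.ext_getElem (by simp) fun i _ _ => by simp

theorem primVar_mem_involving (l k : List V) (z : V) : primVar R l k z ∈ involving R z :=
  (primVar_isMultihomogeneous l k z).mem_involving (by simp)

theorem primVar_identity (l k : List V) (z : V) :
    (varProd R l * varProd R k) * X R z - varProd R l * (varProd R k * X R z) =
      splitSum (fun l₁ l₂ => splitSum (fun k₁ k₂ =>
        (varProd R l₁ * varProd R k₁) * primVar R l₂ k₂ z) k) l := by
  rw [varProd, varProd, primList_identity, splitSum_map]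
  refine splitSum_congr (fun l₁ l₂ => ?_) l
  rw [splitSum_map]
  rfl

theorem primVar_nil_left (k : List V) (z : V) : primVar R [] k z = 0 := primList_nil_left _ _

theorem primVar_nil_right (l : List V) (z : V) : primVar R l [] z = 0 := primList_nil_right _ _

end NAPowerSeries

/-! ### Deviations of the series `1 + x'` modulo repeated letters -/

namespace UnitSeries

open NAPowerSeries

variable {V : Type u} {R : Type v} [CommRing R]

/-- The series `1 + x'`. -/
noncomputable def oneAddX (R : Type v) [CommRing R] (x : V) : UnitSeries V R :=
  ⟨1 + X R x, by rw [coeff_add, coeff_one_one, coeff_one_X, add_zero]⟩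

theorem val_oneAddX (x : V) : (oneAddX R x).1 = 1 + X R x := rfl

/-- The left-normed product of the series `1 + x'`. -/
noncomputable def oneAddXProd (R : Type v) [CommRing R] (l : List V) : UnitSeries V R :=
  l.foldl (fun g x => g * oneAddX R x) 1

theorem oneAddXProd_concat (l : List V) (x : V) :
    oneAddXProd R (l ++ [x]) = oneAddXProd R l * oneAddX R x := by
  simp [oneAddXProd]

theorem oneAddXProd_singleton (x : V) : oneAddXProd R [x] = oneAddX R x := one_mul _

/-- Each factor contributes either `1` or its variable, and dropping factors `1` leaves a
left-normed product left-normed. -/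
theorem val_oneAddXProd (l : List V) : (oneAddXProd R l).1 = subSum (varProd R) l := by
  induction l using List.reverseRecOn with
  | nil => rfl
  | append_singleton l x ih =>
    rw [oneAddXProd_concat, val_mul, val_oneAddX, mul_add, mul_one, ih, subSum_concat, subSum_mul]
    congr 1
    exact subSum_congr (fun s => (varProd_concat s x).symm) l

/-- Expanding both products and applying `primVar_identity` to each pair of subsequences gives terms
`(u₁v₁) p(u₂; v₂; z)` with `u₁, u₂` complementary in a subsequence of `l`, and likewise in `k`.
Terms in which `u₁, u₂` or `v₁, v₂` share a letter vanish, so all four may range independently and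
the sum factors. -/
theorem multilinearTrunc_associator_prod (l k : List V) (z : V) :
    multilinearTrunc V R (((oneAddXProd R l).1 * (oneAddXProd R k).1) * X R z -
        (oneAddXProd R l).1 * ((oneAddXProd R k).1 * X R z)) =
      multilinearTrunc V R (((oneAddXProd R l).1 * (oneAddXProd R k).1) *
        subSum (fun s => subSum (fun t => primVar R s t z) k) l) := by
  have hzero : ∀ l₁ l₂ k₁ k₂ : List V, (¬ l₁.Disjoint l₂ ∨ ¬ k₁.Disjoint k₂) →
      multilinearTrunc V R ((varProd R l₁ * varProd R k₁) * primVar R l₂ k₂ z) = 0 := by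
    intro l₁ l₂ k₁ k₂ h
    refine (((varProd_isMultihomogeneous l₁).mul (varProd_isMultihomogeneous k₁)).mul
      (primVar_isMultihomogeneous l₂ k₂ z)).multilinearTrunc_eq_zero fun hn => ?_
    rw [← Multiset.coe_singleton, Multiset.coe_add, Multiset.coe_add, Multiset.coe_add,
      Multiset.coe_add, Multiset.coe_nodup] at hn
    have hd := List.disjoint_of_nodup_append hn
    rcases h with h | h
    · exact h fun a ha hb => hd (List.mem_append_left _ ha)
        (List.mem_append_left _ (List.mem_append_left _ hb))
    · exact h fun a ha hb => hd (List.mem_append_right _ ha)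
        (List.mem_append_left _ (List.mem_append_right _ hb))
  have hl : ((oneAddXProd R l).1 * (oneAddXProd R k).1) * X R z -
      (oneAddXProd R l).1 * ((oneAddXProd R k).1 * X R z) =
      subSum (fun s => subSum (fun t => splitSum (fun l₁ l₂ => splitSum (fun k₁ k₂ =>
        (varProd R l₁ * varProd R k₁) * primVar R l₂ k₂ z) t) s) k) l := by
    simp only [val_oneAddXProd, subSum_mul, mul_subSum, ← subSum_sub, primVar_identity]
    rw [subSum_comm]
  have hd : ∀ {s t : List V} {a : V}, a ∈ s → a ∈ t → ¬ s.Disjoint t := fun hs ht h => h hs ht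
  have hm : ∀ F : List V → NAPowerSeries V R, ∀ l, multilinearTrunc V R (subSum F l) =
      subSum (fun s => multilinearTrunc V R (F s)) l :=
    map_subSum (multilinearTrunc V R).toAddMonoidHom
  have hm' : ∀ F : List V → List V → NAPowerSeries V R, ∀ l, multilinearTrunc V R (splitSum F l) =
      splitSum (fun s t => multilinearTrunc V R (F s t)) l :=
    map_splitSum (multilinearTrunc V R).toAddMonoidHom
  rw [hl]
  simp only [hm, hm']
  rw [subSum_congr (fun s => subSum_splitSum_comm (fun t l₁ l₂ => splitSum (fun k₁ k₂ =>
    multilinearTrunc V R ((varProd R l₁ * varProd R k₁) * primVar R l₂ k₂ z)) t) k s) l]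
  have hk : ∀ l₁ l₂, subSum (fun t => splitSum (fun k₁ k₂ =>
      multilinearTrunc V R ((varProd R l₁ * varProd R k₁) * primVar R l₂ k₂ z)) t) k =
      subSum (fun k₁ => subSum (fun k₂ =>
        multilinearTrunc V R ((varProd R l₁ * varProd R k₁) * primVar R l₂ k₂ z)) k) k :=
    fun l₁ l₂ => subSum_splitSum _ (fun k₁ k₂ a h h' => hzero _ _ _ _ (Or.inr (hd h h'))) k
  simp only [hk]
  rw [subSum_splitSum]
  · simp only [val_oneAddXProd, subSum_mul, mul_subSum, hm]
    rw [subSum_comm]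
    refine subSum_congr (fun l₂ => ?_) l
    rw [subSum_congr (fun l₁ => subSum_comm _ k k) l, subSum_comm]
    exact subSum_congr (fun k₂ => subSum_comm _ l k) k
  · intro l₁ l₂ a h h'
    simp only [hzero _ _ _ _ (Or.inl (hd h h')), subSum_zero]

/-- The associator of left-normed products of the series `1 + x'`, modulo monomials with repeated
letters. -/
theorem multilinearTrunc_loopAssociator (l k : List V) (z : V) :
    multilinearTrunc V R
        (loopAssociator (oneAddXProd R l) (oneAddXProd R k) (oneAddX R z)).1 =
      multilinearTrunc V R (1 + subSum (fun s => subSum (fun t => primVar R s t z) k) l) := by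
  refine trunc_ldiv _ ?_
  have h := multilinearTrunc_associator_prod (R := R) l k z
  have hz : (oneAddXProd R l).1 * ((oneAddXProd R k).1 * X R z) ∈ involving R z :=
    mul_mem_involving _ (mul_mem_involving _
      ((IsMultihomogeneous.X z).mem_involving (Multiset.mem_singleton_self z)))
  have hQ : subSum (fun s => subSum (fun t => primVar R s t z) k) l ∈ involving R z :=
    subSum_mem _ _ (fun s => subSum_mem _ _ (fun t => primVar_mem_involving s t z) k) l
  -- With `a`, `b` the two products and `Q` the sum of primitive operations, the term `(a(bz))Q`
  -- contains `z` twice, so `(a(b(1 + z)))(1 + Q)` reduces to `ab + a(bz) + (ab)Q = (ab)(1 + z)`.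
  have h0 := multilinearTrunc_mul_eq_zero hz hQ
  simp only [val_mul, val_oneAddX, mul_add, mul_one, add_mul, map_add]
  rw [map_sub, sub_eq_iff_eq_add] at h
  rw [h, map_mul _ (_ * (_ * _)) (subSum _ _), h0]
  abel

/-- The deviation of deviations, if the products of the terms containing `z` vanish. -/
theorem multilinearTrunc_ldiv_mul {z : V} {a b c : UnitSeries V R} {f g h : NAPowerSeries V R}
    (hf : f ∈ involving R z) (hg : g ∈ involving R z) (hh : h ∈ involving R z)
    (ha : multilinearTrunc V R a.1 = multilinearTrunc V R (1 + f))
    (hb : multilinearTrunc V R b.1 = multilinearTrunc V R (1 + g))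
    (hc : multilinearTrunc V R c.1 = multilinearTrunc V R (1 + h)) :
    multilinearTrunc V R (Loop.ldiv (a * b) c).1 = multilinearTrunc V R (1 + (h - f - g)) := by
  refine trunc_ldiv _ ?_
  have hr : h - f - g ∈ involving R z := sub_mem (sub_mem hh hf) hg
  -- All cross terms vanish: with `r = h - f - g`, `((1 + f)(1 + g))(1 + r)` becomes `1 + f + g + r
  -- = 1 + h`.
  have h1 := multilinearTrunc_mul_eq_zero hf hg
  have h2 := multilinearTrunc_mul_eq_zero hf hr
  have h3 := multilinearTrunc_mul_eq_zero hg hr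
  rw [val_mul, map_mul, map_mul, ha, hb, hc, map_add, map_add, map_add, map_add]
  simp only [map_one, add_mul, mul_add, one_mul, mul_one, h1, h2, h3, add_zero]
  simp only [map_sub]
  abel

/-- The first entry must be a product over an arbitrary list `l`, because contraction at place `0`
multiplies it by the next entry. For `T = a :: T'` the three inner deviations belong to `l`, `[a]`
and `l ++ [a]`, and their defect puts `a` in front of `T'`. -/
theorem multilinearTrunc_seqDeviation_zeros (T : List V) (l k : List V) (z : V)
    (e : ℕ → UnitSeries V R) (h0 : e 0 = oneAddXProd R l)
    (hT : ∀ i (h : i < T.length), e (i + 1) = oneAddX R T[i])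
    (hk : e (T.length + 1) = oneAddXProd R k) (hz : e (T.length + 2) = oneAddX R z) :
    multilinearTrunc V R (seqDeviation (List.replicate T.length 0) e).1 =
      multilinearTrunc V R (1 +
        subSumNonempty (fun s => subSum (fun t => primVar R (s ++ T) t z) k) l) := by
  induction T generalizing l e with
  | nil =>
    have h1 : seqDeviation (List.replicate ([] : List V).length 0) e =
        loopAssociator (oneAddXProd R l) (oneAddXProd R k) (oneAddX R z) := by
      rw [← h0, ← hk, ← hz]
      rfl
    rw [h1, multilinearTrunc_loopAssociator, subSumNonempty]
    simp only [List.append_nil, primVar_nil_left, subSum_zero, sub_zero]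
  | cons a T ih =>
    have ih' : ∀ (l' : List V) (t : UnitSeries V R), t = oneAddXProd R l' →
        multilinearTrunc V R (seqDeviation (List.replicate T.length 0) (contractAt 0 t e)).1 =
          multilinearTrunc V R (1 +
            subSumNonempty (fun s => subSum (fun t => primVar R (s ++ T) t z) k) l') :=
      fun l' t ht => ih l' _ (by rw [contractAt_self, ht])
        (fun i h => by
          rw [contractAt_of_gt (by omega), hT (i + 1) (by simpa using h)]
          rfl)
        (by rw [contractAt_of_gt (by omega)]; exact hk)
        (by rw [contractAt_of_gt (by omega)]; exact hz)
    have hmem : ∀ l', subSumNonempty (fun s => subSum (fun t => primVar R (s ++ T) t z) k) l' ∈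
        involving R z := fun l' =>
      sub_mem (subSum_mem _ _ (fun s => subSum_mem _ _ (fun t => primVar_mem_involving _ t z) k) l')
        (subSum_mem _ _ (fun t => primVar_mem_involving _ t z) k)
    have ha : e 1 = oneAddX R a := hT 0 (by simp)
    rw [List.length_cons, List.replicate_succ, seqDeviation, multilinearTrunc_ldiv_mul
      (hmem l) (hmem [a]) (hmem (l ++ [a])) (ih' l _ h0)
      (ih' [a] _ (by rw [ha, oneAddXProd_singleton]))
      (ih' (l ++ [a]) _ (by rw [oneAddXProd_concat, h0, ha])), subSumNonempty_concat]
    simp only [List.append_assoc, List.singleton_append]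

/-- The same induction at the place of the `y` block. The deviations in the `x` block are the inner
ones and form the base case, where the initial list is a single letter and so only the full sequence
`xs` survives. -/
theorem multilinearTrunc_seqDeviation (xs T k : List V) (hxs : xs ≠ []) (z : V)
    (e : ℕ → UnitSeries V R) (hx : ∀ i (h : i < xs.length), e i = oneAddX R xs[i])
    (hk : e xs.length = oneAddXProd R k)
    (hT : ∀ i (h : i < T.length), e (xs.length + 1 + i) = oneAddX R T[i])
    (hz : e (xs.length + 1 + T.length) = oneAddX R z) :
    multilinearTrunc V R (seqDeviation
        (List.replicate T.length xs.length ++ List.replicate (xs.length - 1) 0) e).1 =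
      multilinearTrunc V R (1 + subSumNonempty (fun s => primVar R xs (s ++ T) z) k) := by
  induction T generalizing k e with
  | nil =>
    obtain ⟨x, xs, rfl⟩ := List.exists_cons_of_ne_nil hxs
    have h := multilinearTrunc_seqDeviation_zeros xs [x] k z e
      (by rw [oneAddXProd_singleton]; exact hx 0 (by simp))
      (fun i h => hx (i + 1) (by simpa using h)) hk hz
    rw [subSumNonempty_singleton] at h
    simpa only [List.length_nil, List.replicate_zero, List.nil_append, List.append_nil,
      List.length_cons, Nat.add_sub_cancel, subSumNonempty, primVar_nil_right, sub_zero,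
      List.singleton_append] using h
  | cons a T ih =>
    have ih' : ∀ (k' : List V) (t : UnitSeries V R), t = oneAddXProd R k' →
        multilinearTrunc V R (seqDeviation
          (List.replicate T.length xs.length ++ List.replicate (xs.length - 1) 0)
          (contractAt xs.length t e)).1 =
          multilinearTrunc V R (1 + subSumNonempty (fun s => primVar R xs (s ++ T) z) k') :=
      fun k' t ht => ih k' _
        (fun i h => by rw [contractAt_of_lt h, hx i h])
        (by rw [contractAt_self, ht])
        (fun i h => by
          rw [contractAt_of_gt (by omega)]
          exact hT (i + 1) (by simpa using h))
        (by rw [contractAt_of_gt (by omega)]; exact hz)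
    have hmem : ∀ k', subSumNonempty (fun s => primVar R xs (s ++ T) z) k' ∈ involving R z :=
      fun k' => sub_mem (subSum_mem _ _ (fun s => primVar_mem_involving _ _ z) k')
        (primVar_mem_involving _ _ z)
    have ha : e (xs.length + 1) = oneAddX R a := hT 0 (by simp)
    rw [List.length_cons, List.replicate_succ, List.cons_append, seqDeviation,
      multilinearTrunc_ldiv_mul (hmem k) (hmem [a]) (hmem (k ++ [a])) (ih' k _ hk)
      (ih' [a] _ (by rw [ha, oneAddXProd_singleton]))
      (ih' (k ++ [a]) _ (by rw [oneAddXProd_concat, hk, ha])), subSumNonempty_concat]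
    simp only [List.append_assoc, List.singleton_append]

end UnitSeries

/-! ### Substitution of letters for letters -/

/-- The words obtained from a given word by replacing each letter by one of its preimages. -/
noncomputable def wordPreimages {S : Type u} {V : Type w} [Fintype S] [DecidableEq V] (f : S → V) :
    FreeMagma V → List (FreeMagma S)
  | .of v => (Finset.univ.filter fun s => f s = v).toList.map FreeMagma.of
  | .mul a b => (wordPreimages f a ×ˢ wordPreimages f b).map fun p => p.1 * p.2

theorem length_of_mem_wordPreimages {S : Type u} {V : Type w} [Fintype S] [DecidableEq V]
    (f : S → V) (a : FreeMagma V) {b : FreeMagma S} (hb : b ∈ wordPreimages f a) :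
    b.length = a.length := by
  induction a using FreeMagma.rec generalizing b with
  | of v =>
    obtain ⟨s, -, rfl⟩ := List.mem_map.mp hb
    rfl
  | mul a a' ih ih' =>
    obtain ⟨⟨c, d⟩, hp, rfl⟩ := List.mem_map.mp hb
    obtain ⟨hc, hd⟩ := List.pair_mem_product.mp hp
    exact congrArg₂ (· + ·) (ih hc) (ih' hd)

theorem sum_map_product {α β M : Type*} [NonUnitalNonAssocSemiring M] (l : List α) (k : List β)
    (f : α → M) (g : β → M) :
    ((l ×ˢ k).map fun p => f p.1 * g p.2).sum = (l.map f).sum * (k.map g).sum := by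
  induction l with
  | nil => simp
  | cons a l ih =>
    rw [List.product_cons, List.map_append, List.sum_append, ih, List.map_cons, List.sum_cons,
      add_mul, List.map_map, ← List.sum_map_mul_left (k) _ (f a)]
    simp only [Function.comp_def]

namespace NAPowerSeries

variable {S : Type u} {V : Type w} {R : Type v} [CommRing R] [Fintype S] [DecidableEq V]

/-- The substitution of letters in a power series in finitely many variables. -/
noncomputable def rename (f : S → V) (g : NAPowerSeries S R) : NAPowerSeries V R :=
  fun w => WithOne.recOneCoe (coeff 1 g)
    (fun a => ((wordPreimages f a).map fun b : FreeMagma S => coeff (b : Monomial S) g).sum) w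

theorem coeff_one_rename (f : S → V) (g : NAPowerSeries S R) :
    coeff 1 (rename f g) = coeff 1 g := rfl

theorem coeff_coe_rename (f : S → V) (g : NAPowerSeries S R) (a : FreeMagma V) :
    coeff (a : Monomial V) (rename f g) =
      ((wordPreimages f a).map fun b : FreeMagma S => coeff (b : Monomial S) g).sum := rfl

/-- Substitution of letters preserves degree; this transports the error estimate from distinct
letters to arbitrary ones. -/
theorem coeff_rename_eq_zero (f : S → V) (g : NAPowerSeries S R) (w : Monomial V)
    (h : ∀ w' : Monomial S, w'.degree = w.degree → coeff w' g = 0) :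
    coeff w (rename f g) = 0 := by
  cases w using WithOne.recOneCoe with
  | one => exact h 1 rfl
  | coe a =>
    rw [coeff_coe_rename]
    refine List.sum_eq_zero fun c hc => ?_
    obtain ⟨b, hb, rfl⟩ := List.mem_map.mp hc
    exact h _ (length_of_mem_wordPreimages f a hb)

theorem rename_add (f : S → V) (g h : NAPowerSeries S R) :
    rename f (g + h) = rename f g + rename f h := by
  ext w
  cases w using WithOne.recOneCoe with
  | one => rfl
  | coe a => simp only [coeff_add, coeff_coe_rename, List.sum_map_add]

theorem rename_one (f : S → V) : rename f (1 : NAPowerSeries S R) = 1 := by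
  ext w
  cases w using WithOne.recOneCoe with
  | one => rw [coeff_one_rename, coeff_one_one, coeff_one_one]
  | coe a => simp [coeff_coe_rename]

/-- A preimage of a product word is a pair of preimages of its factors, so the sum over preimages
factors as well. -/
theorem rename_mul (f : S → V) (g h : NAPowerSeries S R) :
    rename f (g * h) = rename f g * rename f h := by
  apply ext_cases
  · simp only [coeff_one_rename, coeff_one_mul]
  · intro v
    simp only [coeff_coe_rename, coeff_of_mul, wordPreimages, List.map_map, Function.comp_def,
      List.sum_map_add, List.sum_map_mul_left, List.sum_map_mul_right, coeff_one_rename]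
  · intro a b
    rw [coeff_mul_mul]
    simp only [coeff_coe_rename, coeff_one_rename]
    rw [← sum_map_product]
    change (((wordPreimages f a ×ˢ wordPreimages f b).map _).map _).sum =
      _ * (((wordPreimages f a ×ˢ wordPreimages f b).map _).map _).sum +
      ((((wordPreimages f a ×ˢ wordPreimages f b).map _).map _).sum * _ + _)
    simp only [List.map_map, Function.comp_def, coeff_mul_mul, List.sum_map_add,
      List.sum_map_mul_left, List.sum_map_mul_right]

/-- The substitution of letters as a homomorphism. -/
noncomputable def renameHom (R : Type v) [CommRing R] (f : S → V) : NAPowerSeries S R →+* NAPowerSeries V R where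
  toFun := rename f
  map_one' := rename_one f
  map_mul' := rename_mul f
  map_zero' := by
    ext w
    exact coeff_rename_eq_zero f 0 w fun _ _ => rfl
  map_add' := rename_add f

theorem coeff_of_X {W : Type*} [DecidableEq W] (v t : W) :
    coeff (FreeMagma.of t : Monomial W) (X R v) = if t = v then 1 else 0 := by
  have h : ((FreeMagma.of t : Monomial W) = FreeMagma.of v) ↔ t = v :=
    ⟨fun h => by injection WithOne.coe_injective h, fun h => h ▸ rfl⟩
  by_cases ht : t = v
  · rw [if_pos ht]
    exact if_pos (h.mpr ht)
  · rw [if_neg ht]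
    exact if_neg (mt h.mp ht)

theorem coeff_X_of_degree_ne {W : Type*} (v : W) {w : Monomial W} (hw : w.degree ≠ 1) :
    coeff w (X R v) = 0 := by
  by_contra h
  refine hw ?_
  rw [← Monomial.card_letters, IsMultihomogeneous.X v w h, Multiset.card_singleton]

theorem renameHom_X (f : S → V) (s : S) : renameHom R f (X R s) = X R (f s) := by
  classical
  refine ext_cases ?_ (fun v => ?_) (fun a b => ?_)
  · exact (coeff_one_X s).trans (coeff_one_X (f s)).symm
  · change coeff _ (rename f (X R s)) = _
    rw [coeff_coe_rename, wordPreimages, List.map_map, Finset.sum_map_toList, coeff_of_X]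
    simp only [Function.comp_apply, coeff_of_X, Finset.sum_ite_eq', Finset.mem_filter,
      Finset.mem_univ, true_and]
    simp only [eq_comm]
  · have hd : Monomial.degree ((a * b : FreeMagma V) : Monomial V) ≠ 1 := by
      have ha := a.length_pos
      have hb := b.length_pos
      change a.length + b.length ≠ 1
      omega
    rw [coeff_X_of_degree_ne _ hd]
    exact coeff_rename_eq_zero f _ _ fun w' hw' => coeff_X_of_degree_ne s (hw' ▸ hd)

end NAPowerSeries

namespace UnitSeries

open NAPowerSeries

variable {S : Type u} {V : Type w} {R : Type v} [CommRing R] [Fintype S] [DecidableEq V]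

/-- The substitution of letters as a homomorphism of loops. -/
noncomputable def renameHom (R : Type v) [CommRing R] (f : S → V) :
    UnitSeries S R →* UnitSeries V R where
  toFun g := ⟨NAPowerSeries.renameHom R f g.1, g.2⟩
  map_one' := Subtype.ext (map_one (NAPowerSeries.renameHom R f))
  map_mul' g h := Subtype.ext (map_mul (NAPowerSeries.renameHom R f) g.1 h.1)

theorem val_renameHom (f : S → V) (g : UnitSeries S R) :
    (renameHom R f g).1 = NAPowerSeries.renameHom R f g.1 := rfl

theorem renameHom_oneAddX (f : S → V) (s : S) :
    renameHom R f (oneAddX R s) = oneAddX R (f s) := by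
  refine Subtype.ext ?_
  rw [val_renameHom, val_oneAddX, val_oneAddX, map_add, map_one, renameHom_X]

end UnitSeries

/-! ### Comparison of coefficients for distinct letters -/

namespace UnitSeries

open NAPowerSeries Monomial

variable {V : Type u} {R : Type v} [CommRing R]

theorem factorClosed_setOf_notMem_letters (s : V) :
    FactorClosed {w : Monomial V | s ∉ letters w} where
  left h hs := h (by rw [letters_mul]; exact Multiset.mem_add.mpr (Or.inl hs))
  right h hs := h (by rw [letters_mul]; exact Multiset.mem_add.mpr (Or.inr hs))

/-- If one of the arguments of a deviation is `1 + s'`, then all monomials of positive degree in the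
deviation contain the letter `s`. -/
theorem coeff_seqDeviation_of_notMem_letters (α : List ℕ)
    (hα : ∀ l k r, α = l ++ k :: r → k < r.length + 3) (e : ℕ → UnitSeries V R) (i : ℕ)
    (hi : i < α.length + 3) (s : V) (he : e i = oneAddX R s) (w : Monomial V)
    (hw : s ∉ letters w) :
    coeff w (seqDeviation α e).1 = coeff w (1 : NAPowerSeries V R) := by
  have hC := factorClosed_setOf_notMem_letters s
  -- Modulo monomials containing `s`, the argument `1 + s'` equals `1`, which makes the whole
  -- deviation `1`.
  have h := trunc_seqDeviation_congr (R := R) hC α e (Function.update e i 1) fun j => by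
    rcases eq_or_ne j i with rfl | hj
    · rw [Function.update_self, he, trunc_eq_iff]
      intro w hw
      rw [val_oneAddX, coeff_add, val_one]
      have : coeff w (X R s) = 0 := by
        by_contra h0
        refine hw ?_
        rw [IsMultihomogeneous.X s w h0]
        exact Multiset.mem_singleton_self s
      rw [this, add_zero]
    · rw [Function.update_of_ne hj]
  rw [seqDeviation_eq_one α (Function.update e i 1) i hi hα (Function.update_self i 1 e), trunc_eq_iff] at h
  exact h w hw

/-- Admissibility of the indices of `P`: an index `M + 1` is followed in the list by at least the
`M` zeros. -/
theorem lt_length_of_replicate_append_eq {M N : ℕ} (l : List ℕ) (k : ℕ) (r : List ℕ)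
    (h : List.replicate N (M + 1) ++ List.replicate M 0 = l ++ k :: r) : k < r.length + 3 := by
  have h1 := congrArg List.length h
  have h2 : k = (List.replicate N (M + 1) ++ List.replicate M 0)[l.length]'(by rw [h]; simp) := by
    simp [h]
  simp only [List.length_append, List.length_replicate, List.length_cons] at h1
  rw [List.getElem_append] at h2
  split_ifs at h2 with h3
  · rw [List.length_replicate] at h3
    rw [List.getElem_replicate] at h2
    omega
  · rw [List.getElem_replicate] at h2
    omega

theorem multilinearTrunc_deviationP (M N : ℕ) (x : Fin (M + 1) → V) (y : Fin (N + 1) → V) (z : V) :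
    multilinearTrunc V R (deviationP (M + 1) (N + 1) (fun i => oneAddX R (x i))
        (fun j => oneAddX R (y j)) (oneAddX R z)).1 =
      multilinearTrunc V R (1 + primOp (M + 1) (N + 1) (fun i => X R (x i)) (fun j => X R (y j))
        (X R z)) := by
  -- The block `y` is split as `k = [y 0]` and the tail `T`; the only nonempty subsequence of `k`
  -- gives back the whole of `y`.
  have h := multilinearTrunc_seqDeviation (R := R) (List.ofFn x) (List.ofFn fun j => y j.succ)
    [y 0] (by simp) z
    (blockSeq (fun i => oneAddX R (x i)) (fun j => oneAddX R (y j)) (oneAddX R z))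
    (fun i h => by
      rw [List.length_ofFn] at h
      rw [blockSeq, dif_pos h, List.getElem_ofFn])
    (by
      rw [List.length_ofFn, oneAddXProd_singleton]
      simp [blockSeq])
    (fun i h => by
      rw [List.length_ofFn] at h
      have h1 : M + 1 + 1 + i - (M + 1) = i + 1 := by omega
      simp only [List.length_ofFn, blockSeq, List.getElem_ofFn, h1]
      rw [dif_neg (by omega), dif_pos (by omega)]
      rfl)
    (by
      simp only [List.length_ofFn, blockSeq]
      rw [dif_neg (by omega), dif_neg (by omega)])
  rw [subSumNonempty_singleton, List.length_ofFn, List.length_ofFn, Nat.add_sub_cancel,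
    ← deviationP_succ_eq_seqDeviation] at h
  rw [h, primVar, List.singleton_append, ← List.ofFn_succ, List.map_ofFn, List.map_ofFn,
    primList_ofFn]
  rfl

/-- The deviation of series `1 + x'` with distinct variables, up to degree `m + n + 1`. -/
theorem coeff_deviationP_of_degree_lt (M N : ℕ)
    (w : Monomial (Option (Fin (M + 1) ⊕ Fin (N + 1)))) (hw : w.degree < M + 1 + (N + 1) + 2) :
    coeff w (deviationP (M + 1) (N + 1) (fun i => oneAddX R (some (Sum.inl i)))
        (fun j => oneAddX R (some (Sum.inr j))) (oneAddX R none)).1 =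
      coeff w (1 + primOp (M + 1) (N + 1) (fun i => X R (some (Sum.inl i)))
        (fun j => X R (some (Sum.inr j))) (X R none)) := by
  by_cases hmem : ∀ s, s ∈ letters w
  · refine (trunc_eq_iff _).mp (multilinearTrunc_deviationP (R := R) M N
      (fun i => some (Sum.inl i)) (fun j => some (Sum.inr j)) none) w ?_
    -- There are `M + N + 3` letters, all of them occur, and the degree is at most `M + N + 3`; so
    -- none is repeated.
    rw [multilinearMonomials, Set.mem_ofPred_eq, ← Multiset.dedup_eq_self]
    have huniv : (letters w).toFinset = Finset.univ :=
      Finset.eq_univ_iff_forall.mpr fun s => Multiset.mem_toFinset.mpr (hmem s)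
    refine Multiset.eq_of_le_of_card_le (Multiset.dedup_le _) ?_
    rw [card_letters, ← Multiset.toFinset_val, Finset.card_val, huniv, Finset.card_univ,
      Fintype.card_option, Fintype.card_sum, Fintype.card_fin, Fintype.card_fin]
    omega
  · obtain ⟨s, hs⟩ := not_forall.mp hmem
    -- Both sides reduce to the coefficient of the series `1`: the multidegree of `p` contains every
    -- letter, and the deviation has no terms of positive degree without `s`.
    have hp : coeff w (primOp (M + 1) (N + 1)
        (fun i => X R (some (Sum.inl i) : Option (Fin (M + 1) ⊕ Fin (N + 1))))
        (fun j => X R (some (Sum.inr j))) (X R none)) = 0 := by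
      by_contra h
      have hl := primOp_X_isMultihomogeneous _ _ _ w h
      refine hs ?_
      rw [hl, Multiset.mem_add, Multiset.mem_add, Multiset.mem_sum, Multiset.mem_sum]
      rcases s with _ | i | j
      · simp
      · exact Or.inl (Or.inl ⟨i, by simp⟩)
      · exact Or.inl (Or.inr ⟨j, by simp⟩)
    rw [coeff_add, hp, add_zero, deviationP_succ_eq_seqDeviation]
    have key : ∃ i < M + N + 3, blockSeq (fun i => oneAddX R (some (Sum.inl i)))
        (fun j => oneAddX R (some (Sum.inr j)))
        (oneAddX R (none : Option (Fin (M + 1) ⊕ Fin (N + 1)))) i = oneAddX R s := by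
      rcases s with _ | i | j
      · refine ⟨M + N + 2, by omega, ?_⟩
        rw [blockSeq, dif_neg (by omega), dif_neg (by omega)]
      · refine ⟨i, by omega, ?_⟩
        rw [blockSeq, dif_pos i.2]
      · refine ⟨M + 1 + j, by omega, ?_⟩
        rw [blockSeq, dif_neg (by omega), dif_pos (by omega)]
        simp
    obtain ⟨i, hi, hei⟩ := key
    exact coeff_seqDeviation_of_notMem_letters _ lt_length_of_replicate_append_eq _ i
      (by simp only [List.length_append, List.length_replicate]; omega) s hei w hs

end UnitSeries

theorem magnusHom_of {V : Type u} {R : Type v} [CommRing R] (x : V) :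
    magnusHom V R (FreeLoop.of x) = UnitSeries.oneAddX R x := rfl

end MagnusLoop

/-! ### The general case by substitution of letters -/

theorem proposition1 {V : Type*} {R : Type*} [CommRing R] (m n : ℕ) (hm : 1 ≤ m) (hn : 1 ≤ n)
    (x : Fin m → V) (y : Fin n → V) (z : V) :
    (∃ E : NAPowerSeries V R,
      (∀ w : Monomial V, w.degree < m + n + 2 → NAPowerSeries.coeff w E = 0) ∧
      magnus R (deviationP m n (fun i => FreeLoop.of (x i)) (fun j => FreeLoop.of (y j))
          (FreeLoop.of z)) =
        1 + primOp m n (fun i => NAPowerSeries.X R (x i)) (fun j => NAPowerSeries.X R (y j))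
          (NAPowerSeries.X R z) + E) ∧
    (∀ w : Monomial V, w.degree ≠ m + n + 1 →
      NAPowerSeries.coeff w (primOp m n (fun i => NAPowerSeries.X R (x i))
        (fun j => NAPowerSeries.X R (y j)) (NAPowerSeries.X R z)) = 0) ∧
    (Nontrivial R →
      primOp m n (fun i => NAPowerSeries.X R (x i)) (fun j => NAPowerSeries.X R (y j))
        (NAPowerSeries.X R z) ≠ 0) := by
  classical
  refine ⟨?_, fun w hw => NAPowerSeries.coeff_primOp_X_of_degree_ne x y z hw,
    fun _ => NAPowerSeries.primOp_X_ne_zero (by omega) (by omega) x y z⟩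
  obtain ⟨M, rfl⟩ := Nat.exists_eq_add_of_le' hm
  obtain ⟨N, rfl⟩ := Nat.exists_eq_add_of_le' hn
  -- The source alphabet has one letter for each argument, with `none` for `z`; `f` may identify
  -- letters.
  let f : Option (Fin (M + 1) ⊕ Fin (N + 1)) → V := fun s => s.elim z (Sum.elim x y)
  let P : UnitSeries (Option (Fin (M + 1) ⊕ Fin (N + 1))) R :=
    deviationP (M + 1) (N + 1) (fun i => UnitSeries.oneAddX R (some (Sum.inl i)))
      (fun j => UnitSeries.oneAddX R (some (Sum.inr j))) (UnitSeries.oneAddX R none)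
  let p : NAPowerSeries (Option (Fin (M + 1) ⊕ Fin (N + 1))) R :=
    primOp (M + 1) (N + 1) (fun i => NAPowerSeries.X R (some (Sum.inl i)))
      (fun j => NAPowerSeries.X R (some (Sum.inr j))) (NAPowerSeries.X R none)
  have hP : magnus R (deviationP (M + 1) (N + 1) (fun i => FreeLoop.of (x i))
      (fun j => FreeLoop.of (y j)) (FreeLoop.of z)) = NAPowerSeries.renameHom R f P.1 := by
    rw [magnus, map_deviationP, ← UnitSeries.val_renameHom, map_deviationP]
    simp only [magnusHom_of, UnitSeries.renameHom_oneAddX]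
    rfl
  have hp : primOp (M + 1) (N + 1) (fun i => NAPowerSeries.X R (x i))
      (fun j => NAPowerSeries.X R (y j)) (NAPowerSeries.X R z) =
        NAPowerSeries.renameHom R f p := by
    rw [map_primOp]
    simp only [NAPowerSeries.renameHom_X]
    rfl
  -- The error term is the image of the error term for distinct letters.
  refine ⟨NAPowerSeries.renameHom R f (P.1 - (1 + p)), fun w hw => ?_, ?_⟩
  · refine NAPowerSeries.coeff_rename_eq_zero f _ w fun w' hw' => ?_
    rw [NAPowerSeries.coeff_sub, sub_eq_zero]
    exact UnitSeries.coeff_deviationP_of_degree_lt M N w' (hw' ▸ hw)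
  · rw [hP, hp, map_sub, map_add, map_one, add_sub_cancel]
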